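/- **Min-Sum Dynamization.** An input is a sequence $I=(I_1,\dots,I_n)$ of pairwise disjoint finite sets of items, each item $x$ having a weight $\mathrm{wt}(x)\ge 0$; for a set $S$ of items let $\mathrm{wt}(S)=\sum_{x\in S}\mathrm{wt}(x)$. A solution is a sequence $\mathcal C=(\mathcal C_1,\dots,\mathcal C_n)$ of collections of sets (called components) with $\bigcup_{S\in\mathcal C_t}S=\bigcup_{i=1}^t I_i$ for every $t$. With $\mathcal C_0=\emptyset$, its cost is $$\sum_{t=1}^n\Big(\sum_{S\in\mathcal C_t\setminus\mathcal C_{t-1}}\mathrm{wt}(S)+|\mathcal C_t|\Big),$$ the total build cost plus the total query cost, and the optimum of $I$ is the least cost of a solution. An algorithm is *online* if on every input it outputs a solution whose cover $\mathcal C_t$ at each time $t$ does not depend on $I_{t+1},\dots,I_n$, on the weights of items not inserted by time $t$, or on $n$. Its *competitive ratio* is the function of $m$ given by the supremum, over all inputs with exactly $m$ non-empty insertions (that is, $m$ indices $t$ with $I_t\neq\emptyset$), of the cost of the algorithm's solution divided by the optimum. The algorithm *adaptive-binary* maintains a cover, initially empty. At each time $t=1,2,\dots,n$ it first adds $I_t$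 as a new component if $I_t\ne\emptyset$; then, letting $2^j$ be the largest power of $2$ dividing $t$, if there are at least two components $S$ with $\mathrm{wt}(S)\le 2^j$, it replaces all of those components by their union. The resulting cover is $\mathcal C_t$. Let $\log^* x=0$ for $x\le 1$ and $\log^* x=1+\log^*(\log_2 x)$ for $x>1$. **Theorem.** The algorithm adaptive-binary is online, and its competitive ratio is $\Theta(\log^* m)$: there are absolute constants $c,C>0$ such that for every integer $m\ge 2$ its competitive ratio on inputs with $m$ non-empty insertions is at least $c\log^* m$ and at most $C\log^* m$. -/

import Mathlib

open scoped NNReal ENNReal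

universe u

/-- The iterated binary logarithm: `log* x = 0` for `x ≤ 1`, and
`log* x = 1 + log* (log₂ x)` for `x > 1`. -/
noncomputable def logStar (x : ℝ) : ℕ :=
  if x ≤ 1 then 0 else 1 + logStar (Real.logb 2 x)
termination_by ⌈x⌉₊
decreasing_by
  have : 1 < x := by linarith
  obtain ⟨k, hk⟩ : ∃ k, ⌈x⌉₊ = k + 1 :=
    Nat.exists_eq_succ_of_ne_zero (Nat.ceil_pos.mpr (by linarith)).ne'
  have h1 : x ≤ (2 : ℝ) ^ (k : ℝ) := by
    have h2 : (k + 1 : ℕ) ≤ 2 ^ k := Nat.lt_two_pow_self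
    have h3 : x ≤ ((k + 1 : ℕ) : ℝ) := hk ▸ Nat.le_ceil x
    have h4 : ((k + 1 : ℕ) : ℝ) ≤ ((2 ^ k : ℕ) : ℝ) := by exact_mod_cast h2
    rw [Real.rpow_natCast]
    push_cast at h3 h4
    linarith
  have h5 : Real.logb 2 x ≤ k :=
    (Real.logb_le_iff_le_rpow (by norm_num) (by linarith)).mpr h1
  have h6 : ⌈Real.logb 2 x⌉₊ ≤ k := Nat.ceil_le.mpr h5
  omega

namespace MinSum

/-- An input `I = (I₁, …, Iₙ)` of Min-Sum Dynamization with items from `α`: pairwise disjoint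
finite sets of items, and a non-negative weight for each item.
Only the values `ins t` with `1 ≤ t ≤ n` are part of the input. -/
structure Input (α : Type u) where
  /-- the number of time steps -/
  n : ℕ
  /-- the set of items inserted at time `t` -/
  ins : ℕ → Finset α
  /-- the weight of an item -/
  wt : α → ℝ≥0
  disjoint_ins : ∀ s ∈ Finset.Icc 1 n, ∀ t ∈ Finset.Icc 1 n, s ≠ t → Disjoint (ins s) (ins t)

namespace Input

variable {α : Type u}

/-- The number of non-empty insertions. -/
def numInsertions (I : Input α) : ℕ :=
  ((Finset.Icc 1 I.n).filter fun t => (I.ins t).Nonempty).card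

/-- The weight of a set of items. -/
noncomputable def weight (I : Input α) (S : Finset α) : ℝ≥0 := ∑ x ∈ S, I.wt x

variable [DecidableEq α]

/-- The set `U_t` of all items inserted by time `t`. -/
def inserted (I : Input α) (t : ℕ) : Finset α := (Finset.Icc 1 t).biUnion I.ins

/-- `C` is a solution: for each time `t` from `1` to `n`, the union of the components
in `C t` is `U_t`. By convention the cover `C 0` is empty. -/
structure IsSolution (I : Input α) (C : ℕ → Finset (Finset α)) : Prop where
  zero : C 0 = ∅
  cover : ∀ t ∈ Finset.Icc 1 I.n, (C t).biUnion id = I.inserted t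

/-- The build cost at time `t`: the total weight of the new components. -/
noncomputable def buildCost (I : Input α) (C : ℕ → Finset (Finset α)) (t : ℕ) : ℝ≥0 :=
  ∑ S ∈ C t \ C (t - 1), I.weight S

/-- The query cost at time `t`: the number of components. -/
def queryCost (C : ℕ → Finset (Finset α)) (t : ℕ) : ℕ := (C t).card

/-- The cost of a solution: the sum of all build costs and query costs. -/
noncomputable def cost (I : Input α) (C : ℕ → Finset (Finset α)) : ℝ≥0 :=
  ∑ t ∈ Finset.Icc 1 I.n, (I.buildCost C t + (queryCost C t : ℝ≥0))

/-- The optimum: the least cost of a solution. -/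
noncomputable def opt (I : Input α) : ℝ≥0∞ :=
  ⨅ (C : ℕ → Finset (Finset α)) (_ : I.IsSolution C), (I.cost C : ℝ≥0∞)

end Input

/-- An algorithm assigns to every input a sequence of covers. -/
abbrev Algorithm : Type (u + 1) :=
  ∀ (α : Type u) [DecidableEq α], Input α → ℕ → Finset (Finset α)

/-- An algorithm is online if its output is always a solution, and its cover at each time `t`
does not depend on later insertions, on the weights of items that are not yet inserted,
or on `n`. -/
def IsOnline (A : Algorithm.{u}) : Prop :=
  ∀ (α : Type u) [DecidableEq α] (I : Input α),
    I.IsSolution (A α I) ∧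
    ∀ (J : Input α) (t : ℕ), t ≤ I.n → t ≤ J.n →
      (∀ i ∈ Finset.Icc 1 t, I.ins i = J.ins i) →
      (∀ x ∈ I.inserted t, I.wt x = J.wt x) →
      A α I t = A α J t

/-- The competitive ratio, as a function of `m`: the supremum, over all inputs with `m` non-empty
insertions, of the cost of the algorithm's solution divided by the optimum.
For `m ≥ 1` the optimum is positive and finite. -/
noncomputable def competitiveRatio (A : Algorithm.{u}) (m : ℕ) : ℝ≥0∞ :=
  ⨆ (α : Type u) (_ : DecidableEq α) (I : Input α) (_ : I.numInsertions = m),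
    (I.cost (A α I) : ℝ≥0∞) / I.opt

section AdaptiveBinary

variable {α : Type u} [DecidableEq α]

/-- The largest power of two that divides `t` (for `t ≥ 1`). -/
def capacity (t : ℕ) : ℕ := 2 ^ padicValNat 2 t

/-- Add `A` as a new component, if `A` is non-empty. -/
def addComponent (C : Finset (Finset α)) (A : Finset α) : Finset (Finset α) :=
  if A.Nonempty then insert A C else C

/-- If there are multiple components of weight at most `r`, merge all of them into one. -/
noncomputable def mergeLight (I : Input α) (C : Finset (Finset α)) (r : ℝ≥0) :
    Finset (Finset α) :=
  let L := C.filter fun S => I.weight S ≤ r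
  if 2 ≤ L.card then insert (L.biUnion id) (C \ L) else C

/-- The cover maintained by the algorithm adaptive-binary after time `t`. -/
noncomputable def adaptiveBinaryCover (I : Input α) : ℕ → Finset (Finset α)
  | 0 => ∅
  | t + 1 => mergeLight I (addComponent (adaptiveBinaryCover I t) (I.ins (t + 1)))
      (capacity (t + 1) : ℝ≥0)

end AdaptiveBinary

/-- The algorithm adaptive-binary. -/
noncomputable def adaptiveBinary : Algorithm.{u} := fun _ _ I => adaptiveBinaryCover I

end MinSum

set_option linter.unusedSectionVars false

namespace MinSum

variable {α : Type u} [DecidableEq α]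

/-! Upper bound. The structural fact is that after time `t` at most one component has weight at most
`capacity t`. Take any solution and one of its components `A`, built at time `b` and kept until `e`.
The items of `A` that the algorithm merges during `[b, e]` are charged to the weight of `A` and to
the length of the interval.

A merge at `t` is late if `b + capacity t ≤ t`. All of `A` is then present at time `t - capacity t`,
where only one component is light enough to take part, so little of `A` is merged; the amounts
telescope to `e - b` (`sum_late_le`). At the other, early, merges the capacities strictly increase.
An item contributes to at most `L` of them before it reaches height `L`. The items of height at
least `k` in an early merge weigh at most `loadFactor m k` times its capacity, and `loadFactor` is
essentially a `k`-fold logarithm of `m`, because the amounts inherited from earlier early merges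
form a capped geometric series (`weight_deepItems_le`). With `L = log* m` the load factor is at most
4, so the build cost is `O(log* m)` times the cost of the solution. The query cost is bounded by the
query cost of the solution plus six times the algorithm's build cost: time is cut into blocks of
length comparable to the weight of a component, and a component that survives a block without being
always the lightest is paid for by a heavier one built there (`sum_blocks_le`).

Lower bound. Without insertions only the times `2 ^ j` matter, and there all weights up to `2 ^ j`
are merged. `expansion` splits a single weight `2 ^ H` repeatedly, so that the merges undo one
splitting after another and each round rebuilds the whole weight (`merge_expansion`). A splitting
costs two exponentials in the number of items, so about `(log* m) / 2` rounds fit into `m`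
insertions, whereas merging everything once costs `O(2 ^ H)`. -/

theorem capacity_pos (t : ℕ) : 0 < capacity t := by unfold capacity; positivity

theorem capacity_dvd (t : ℕ) : capacity t ∣ t := pow_padicValNat_dvd

theorem two_pow_le_capacity {j t : ℕ} (ht : t ≠ 0) (h : 2 ^ j ∣ t) : 2 ^ j ≤ capacity t :=
  Nat.pow_le_pow_right (by norm_num) ((padicValNat_dvd_iff_le ht).1 h)

theorem capacity_le {t : ℕ} (ht : t ≠ 0) : capacity t ≤ t :=
  Nat.le_of_dvd (Nat.pos_of_ne_zero ht) (capacity_dvd t)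

theorem capacity_dvd_of_le {s t : ℕ} (h : capacity s ≤ capacity t) : capacity s ∣ t :=
  (pow_dvd_pow 2 ((Nat.pow_le_pow_iff_right (by norm_num)).1 h)).trans (capacity_dvd t)

theorem sum_biUnion_le {ι β : Type*} [DecidableEq β] (s : Finset ι) (f : ι → Finset β)
    (w : β → ℝ≥0) : ∑ x ∈ s.biUnion f, w x ≤ ∑ i ∈ s, ∑ x ∈ f i, w x := by
  classical
  induction s using Finset.induction_on with
  | empty => simp
  | insert a s ha ih =>
    rw [Finset.biUnion_insert, Finset.sum_insert ha]
    refine le_trans ?_ (add_le_add_right ih _)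
    rw [← Finset.sum_union_inter]
    exact le_self_add

namespace Input

variable (I : Input α)

theorem weight_mono {S T : Finset α} (h : S ⊆ T) : I.weight S ≤ I.weight T :=
  Finset.sum_le_sum_of_subset h

theorem weight_biUnion_le {ι : Type*} (s : Finset ι) (f : ι → Finset α) :
    I.weight (s.biUnion f) ≤ ∑ i ∈ s, I.weight (f i) :=
  sum_biUnion_le s f I.wt

theorem weight_biUnion {ι : Type*} {s : Finset ι} {f : ι → Finset α}
    (h : (s : Set ι).PairwiseDisjoint f) :
    I.weight (s.biUnion f) = ∑ i ∈ s, I.weight (f i) :=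
  Finset.sum_biUnion h

theorem inserted_zero : I.inserted 0 = ∅ := by simp [inserted]

theorem inserted_succ (t : ℕ) : I.inserted (t + 1) = I.inserted t ∪ I.ins (t + 1) := by
  unfold inserted
  rw [← Finset.insert_Icc_right_eq_Icc_add_one (by omega), Finset.biUnion_insert, Finset.union_comm]

theorem inserted_mono : Monotone I.inserted := fun _ _ h =>
  Finset.biUnion_subset_biUnion_of_subset_left _ (Finset.Icc_subset_Icc_right h)

theorem disjoint_inserted_ins {t : ℕ} (ht : t + 1 ≤ I.n) :
    Disjoint (I.inserted t) (I.ins (t + 1)) := by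
  unfold inserted
  rw [Finset.disjoint_biUnion_left]
  intro i hi
  rw [Finset.mem_Icc] at hi
  apply I.disjoint_ins <;> simp <;> omega

end Input

/-! ### Structure of the cover: one light component, disjointness, laminarity, and onlineness -/

section Cover

variable (I : Input α)

/-- The components available at time `t + 1`, before merging. -/
noncomputable def available (t : ℕ) : Finset (Finset α) :=
  addComponent (adaptiveBinaryCover I t) (I.ins (t + 1))

/-- The available components at time `t + 1` that are light enough to be merged. -/
noncomputable def light (t : ℕ) : Finset (Finset α) :=
  (available I t).filter fun S => I.weight S ≤ (capacity (t + 1) : ℝ≥0)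

/-- The component that results from the merge at time `t`, or the empty set if there is none. -/
noncomputable def merged : ℕ → Finset α
  | 0 => ∅
  | t + 1 => if 2 ≤ (light I t).card then (light I t).biUnion id else ∅

variable {I}

theorem mem_available {t : ℕ} {S : Finset α} :
    S ∈ available I t ↔ S ∈ adaptiveBinaryCover I t ∨ (S.Nonempty ∧ S = I.ins (t + 1)) := by
  unfold available addComponent
  split_ifs with h
  · rw [Finset.mem_insert]
    constructor
    · rintro (rfl | h')
      · exact Or.inr ⟨h, rfl⟩
      · exact Or.inl h'
    · rintro (h' | h')
      · exact Or.inr h'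
      · exact Or.inl h'.2
  · constructor
    · exact Or.inl
    · rintro (h' | ⟨h', rfl⟩)
      · exact h'
      · exact absurd h' h

theorem cover_succ (t : ℕ) :
    adaptiveBinaryCover I (t + 1) =
      if 2 ≤ (light I t).card then insert ((light I t).biUnion id) (available I t \ light I t)
      else available I t := rfl

theorem mem_light {t : ℕ} {S : Finset α} :
    S ∈ light I t ↔ S ∈ available I t ∧ I.weight S ≤ (capacity (t + 1) : ℝ≥0) :=
  Finset.mem_filter

theorem light_subset (t : ℕ) : light I t ⊆ available I t := Finset.filter_subset _ _

/-- After each time step at most one component is light. -/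
theorem eq_of_light {t : ℕ} {S T : Finset α}
    (hS : S ∈ adaptiveBinaryCover I t) (hT : T ∈ adaptiveBinaryCover I t)
    (hS' : I.weight S ≤ (capacity t : ℝ≥0)) (hT' : I.weight T ≤ (capacity t : ℝ≥0)) : S = T := by
  cases t with
  | zero => simp [adaptiveBinaryCover] at hS
  | succ t =>
    rw [cover_succ] at hS hT
    split_ifs at hS hT with h
    · have key : ∀ R ∈ insert ((light I t).biUnion id) (available I t \ light I t),
          I.weight R ≤ (capacity (t + 1) : ℝ≥0) → R = (light I t).biUnion id := by
        intro R hR hR'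
        rw [Finset.mem_insert, Finset.mem_sdiff] at hR
        rcases hR with hR | hR
        · exact hR
        · exact absurd (mem_light.2 ⟨hR.1, hR'⟩) hR.2
      rw [key S hS hS', key T hT hT']
    · have h1 : (light I t).card ≤ 1 := by omega
      exact Finset.card_le_one.1 h1 S (mem_light.2 ⟨hS, hS'⟩) T (mem_light.2 ⟨hT, hT'⟩)

theorem eq_of_light_of_dvd {j t : ℕ} (h : 2 ^ j ∣ t) {S T : Finset α}
    (hS : S ∈ adaptiveBinaryCover I t) (hT : T ∈ adaptiveBinaryCover I t)
    (hS' : I.weight S ≤ 2 ^ j) (hT' : I.weight T ≤ 2 ^ j) : S = T := by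
  rcases eq_or_ne t 0 with rfl | ht
  · simp [adaptiveBinaryCover] at hS
  · have h1 : (2 : ℝ≥0) ^ j ≤ (capacity t : ℝ≥0) := by
      exact_mod_cast two_pow_le_capacity ht h
    exact eq_of_light hS hT (hS'.trans h1) (hT'.trans h1)

theorem exists_superset_of_available {t : ℕ} {S : Finset α} (hS : S ∈ available I t) :
    ∃ T ∈ adaptiveBinaryCover I (t + 1), S ⊆ T := by
  rw [cover_succ]
  split_ifs with h
  · by_cases hl : S ∈ light I t
    · exact ⟨_, Finset.mem_insert_self _ _, Finset.subset_biUnion_of_mem id hl⟩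
    · exact ⟨S, Finset.mem_insert_of_mem (Finset.mem_sdiff.2 ⟨hS, hl⟩), subset_rfl⟩
  · exact ⟨S, hS, subset_rfl⟩

theorem exists_superset {s t : ℕ} (h : s ≤ t) {S : Finset α}
    (hS : S ∈ adaptiveBinaryCover I s) : ∃ T ∈ adaptiveBinaryCover I t, S ⊆ T := by
  induction t, h using Nat.le_induction with
  | base => exact ⟨S, hS, subset_rfl⟩
  | succ t _ ih =>
    obtain ⟨T, hT, hST⟩ := ih
    obtain ⟨R, hR, hTR⟩ := exists_superset_of_available (mem_available.2 (Or.inl hT))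
    exact ⟨R, hR, hST.trans hTR⟩

theorem nonempty_of_mem_available {t : ℕ}
    (h : ∀ S ∈ adaptiveBinaryCover I t, S.Nonempty) {S : Finset α}
    (hS : S ∈ available I t) : S.Nonempty := by
  rcases mem_available.1 hS with hS | hS
  · exact h S hS
  · exact hS.1

theorem nonempty_of_mem_cover {t : ℕ} {S : Finset α} (hS : S ∈ adaptiveBinaryCover I t) :
    S.Nonempty := by
  induction t generalizing S with
  | zero => simp [adaptiveBinaryCover] at hS
  | succ t ih =>
    rw [cover_succ] at hS
    split_ifs at hS with h
    · rw [Finset.mem_insert, Finset.mem_sdiff] at hS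
      rcases hS with rfl | hS
      · obtain ⟨T, hT⟩ : (light I t).Nonempty := Finset.card_pos.1 (by omega)
        exact (nonempty_of_mem_available (fun S => ih) (mem_light.1 hT).1).mono
          (Finset.subset_biUnion_of_mem id hT)
      · exact nonempty_of_mem_available (fun S => ih) hS.1
    · exact nonempty_of_mem_available (fun S => ih) hS

theorem biUnion_available (t : ℕ) :
    (available I t).biUnion id = (adaptiveBinaryCover I t).biUnion id ∪ I.ins (t + 1) := by
  unfold available addComponent
  split_ifs with h
  · rw [Finset.biUnion_insert, Finset.union_comm]; rfl
  · rw [Finset.not_nonempty_iff_eq_empty.1 h, Finset.union_empty]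

theorem biUnion_cover (t : ℕ) : (adaptiveBinaryCover I t).biUnion id = I.inserted t := by
  induction t with
  | zero => simp [adaptiveBinaryCover, Input.inserted]
  | succ t ih =>
    rw [Input.inserted_succ, ← ih, ← biUnion_available, cover_succ]
    split_ifs with h
    · rw [Finset.biUnion_insert, id, ← Finset.union_biUnion,
        Finset.union_sdiff_of_subset
          (light_subset t)]
    · rfl

theorem subset_inserted {t : ℕ} {S : Finset α} (hS : S ∈ adaptiveBinaryCover I t) :
    S ⊆ I.inserted t := by
  rw [← biUnion_cover]
  exact Finset.subset_biUnion_of_mem id hS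

theorem pairwiseDisjoint_available {t : ℕ} (ht : t + 1 ≤ I.n)
    (h : (adaptiveBinaryCover I t : Set (Finset α)).PairwiseDisjoint id) :
    (available I t : Set (Finset α)).PairwiseDisjoint id := by
  intro S hS T hT hne
  rcases mem_available.1 hS with hS | ⟨-, rfl⟩ <;> rcases mem_available.1 hT with hT | ⟨-, rfl⟩
  · exact h hS hT hne
  · exact (I.disjoint_inserted_ins ht).mono_left (subset_inserted hS)
  · exact ((I.disjoint_inserted_ins ht).mono_left (subset_inserted hT)).symm
  · exact absurd rfl hne

theorem pairwiseDisjoint_cover {t : ℕ} (ht : t ≤ I.n) :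
    (adaptiveBinaryCover I t : Set (Finset α)).PairwiseDisjoint id := by
  induction t with
  | zero => simp [adaptiveBinaryCover]
  | succ t ih =>
    have h := pairwiseDisjoint_available ht (ih (by omega))
    rw [cover_succ]
    split_ifs with hc
    · rw [Finset.coe_insert]
      refine Set.PairwiseDisjoint.insert (h.subset ?_) ?_
      · exact_mod_cast Finset.sdiff_subset
      · intro S hS _
        rw [Finset.mem_coe, Finset.mem_sdiff] at hS
        change Disjoint ((light I t).biUnion id) S
        rw [Finset.disjoint_biUnion_left]
        intro T hT
        refine h (mem_light.1 hT).1 hS.1 ?_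
        rintro rfl
        exact hS.2 hT
    · exact h

theorem eq_of_mem_cover {t : ℕ} (ht : t ≤ I.n) {S T : Finset α} {x : α}
    (hS : S ∈ adaptiveBinaryCover I t) (hT : T ∈ adaptiveBinaryCover I t) (hxS : x ∈ S)
    (hxT : x ∈ T) : S = T :=
  (pairwiseDisjoint_cover ht).elim_finset hS hT x hxS hxT

theorem exists_mem_cover {t : ℕ} {x : α} (hx : x ∈ I.inserted t) :
    ∃ S ∈ adaptiveBinaryCover I t, x ∈ S := by
  rw [← biUnion_cover, Finset.mem_biUnion] at hx
  exact hx

/-- The components of the cover at an earlier time are contained in any later component that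
they meet. -/
theorem subset_of_mem_cover {s t : ℕ} (hst : s ≤ t) (ht : t ≤ I.n) {S T : Finset α} {x : α}
    (hS : S ∈ adaptiveBinaryCover I s) (hT : T ∈ adaptiveBinaryCover I t) (hxS : x ∈ S)
    (hxT : x ∈ T) : S ⊆ T := by
  obtain ⟨R, hR, hSR⟩ := exists_superset hst hS
  rwa [eq_of_mem_cover ht hT hR hxT (hSR hxS)]

/-- The times at which a set is a component form an interval. -/
theorem mem_cover_of_mem_of_mem {a b c : ℕ} (hab : a ≤ b) (hbc : b ≤ c) (hc : c ≤ I.n)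
    {S : Finset α} (ha : S ∈ adaptiveBinaryCover I a) (hc' : S ∈ adaptiveBinaryCover I c) :
    S ∈ adaptiveBinaryCover I b := by
  obtain ⟨T, hT, hST⟩ := exists_superset hab ha
  obtain ⟨x, hx⟩ := nonempty_of_mem_cover ha
  have : T ⊆ S := subset_of_mem_cover hbc hc hT hc' (hST hx) hx
  rwa [Finset.Subset.antisymm hST this]

theorem isSolution_adaptiveBinaryCover (I : Input α) : I.IsSolution (adaptiveBinaryCover I) :=
  ⟨rfl, fun t _ => biUnion_cover t⟩

theorem adaptiveBinaryCover_congr (J : Input α) (t : ℕ)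
    (hins : ∀ i ∈ Finset.Icc 1 t, I.ins i = J.ins i)
    (hwt : ∀ x ∈ I.inserted t, I.wt x = J.wt x) :
    adaptiveBinaryCover I t = adaptiveBinaryCover J t := by
  induction t with
  | zero => rfl
  | succ t ih =>
    have ih' := ih (fun i hi => hins i (Finset.Icc_subset_Icc_right (by omega) hi))
      (fun x hx => hwt x (I.inserted_mono (by omega) hx))
    have ha : available I t = available J t := by
      unfold available
      rw [ih', hins (t + 1) (by simp)]
    have hw : ∀ S ∈ available I t, I.weight S = J.weight S := by
      intro S hS
      refine Finset.sum_congr rfl fun x hx => hwt x ?_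
      rw [Input.inserted_succ, ← biUnion_cover, ← biUnion_available]
      exact Finset.mem_biUnion.2 ⟨S, hS, hx⟩
    have hl : light I t = light J t := by
      unfold light
      rw [← ha]
      exact Finset.filter_congr fun S hS => by rw [hw S hS]
    rw [cover_succ, cover_succ, ha, hl]

theorem isOnline_adaptiveBinary : IsOnline adaptiveBinary.{u} := fun _ _ I =>
  ⟨isSolution_adaptiveBinaryCover I, fun J t _ _ hins hwt =>
    adaptiveBinaryCover_congr J t hins hwt⟩

end Cover

/-- Both times are multiples of the smaller capacity, hence so is their distance. -/
theorem capacity_le_sub {s t : ℕ} (hst : s < t) (h : capacity s ≤ capacity t) :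
    capacity s ≤ t - s :=
  Nat.le_of_dvd (by omega) (Nat.dvd_sub (capacity_dvd_of_le h) (capacity_dvd s))

/-- Otherwise `capacity t` would divide the positive number `t - s`, which is smaller. -/
theorem capacity_lt_capacity {s t : ℕ} (hst : s < t) (h : t < s + capacity t) :
    capacity s < capacity t := by
  by_contra! h'
  have := Nat.le_of_dvd (by omega) (Nat.dvd_sub (capacity_dvd t) (capacity_dvd_of_le h'))
  omega

/-! ### Telescoping and geometric sums -/

section Telescope

/-- If the value at each point of `s` is at most the distance from any earlier point of `s`
and from `b`, then the values sum to at most `e - b`. -/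
theorem sum_le_of_le_sub_left {s : Finset ℕ} {f : ℕ → ℝ≥0} {b e : ℕ} (hbe : b ≤ e)
    (he : ∀ t ∈ s, t ≤ e) (h0 : ∀ t ∈ s, b ≤ t ∧ f t ≤ ((t - b : ℕ) : ℝ≥0))
    (h : ∀ t₁ ∈ s, ∀ t₂ ∈ s, t₁ < t₂ → f t₂ ≤ ((t₂ - t₁ : ℕ) : ℝ≥0)) :
    ∑ t ∈ s, f t ≤ ((e - b : ℕ) : ℝ≥0) := by
  induction s using Finset.induction_on_max generalizing e with
  | empty => simp
  | insert a s ha ih =>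
    rw [Finset.sum_insert fun h => (ha a h).false]
    have hae : a ≤ e := he a (by simp)
    rcases s.eq_empty_or_nonempty with rfl | hne
    · rw [Finset.sum_empty, add_zero]
      refine (h0 a (by simp)).2.trans ?_
      exact_mod_cast Nat.sub_le_sub_right hae b
    · have hp := s.max'_mem hne
      have hpa := ha _ hp
      have hbp := (h0 _ (Finset.mem_insert_of_mem hp)).1
      have h1 := ih (e := s.max' hne) hbp (fun t ht => s.le_max' t ht)
        (fun t ht => h0 t (Finset.mem_insert_of_mem ht))
        (fun t₁ h₁ t₂ h₂ => h t₁ (Finset.mem_insert_of_mem h₁) t₂ (Finset.mem_insert_of_mem h₂))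
      have h2 := h _ (Finset.mem_insert_of_mem hp) a (by simp) hpa
      refine (add_le_add h2 h1).trans ?_
      rw [← Nat.cast_add]
      exact_mod_cast (by omega)

theorem sum_le_of_le_sub_right {s : Finset ℕ} {f : ℕ → ℝ≥0} {b e : ℕ} {g : ℝ≥0}
    (hs : ∀ t ∈ s, b ≤ t ∧ t < e) (h0 : ∀ t ∈ s, f t ≤ g * ((e - t : ℕ) : ℝ≥0))
    (h : ∀ t₁ ∈ s, ∀ t₂ ∈ s, t₁ < t₂ → f t₁ ≤ g * ((t₂ - t₁ : ℕ) : ℝ≥0)) :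
    ∑ t ∈ s, f t ≤ g * ((e - b : ℕ) : ℝ≥0) := by
  induction s using Finset.induction_on_max generalizing e with
  | empty => simp
  | insert a s ha ih =>
    rw [Finset.sum_insert fun h => (ha a h).false]
    obtain ⟨hba, hae⟩ := hs a (by simp)
    have h1 := ih (e := a) (fun t ht => ⟨(hs t (Finset.mem_insert_of_mem ht)).1, ha t ht⟩)
      (fun t ht => h t (Finset.mem_insert_of_mem ht) a (by simp) (ha t ht))
      (fun t₁ h₁ t₂ h₂ => h t₁ (Finset.mem_insert_of_mem h₁) t₂ (Finset.mem_insert_of_mem h₂))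
    refine (add_le_add (h0 a (by simp)) h1).trans (le_of_eq ?_)
    rw [← mul_add, ← Nat.cast_add]
    congr 2
    omega

/-- Each point is paid by the gap to its successor; the last one has no successor and is paid by
`W`. -/
theorem sum_le_add_of_le_sub_right {s : Finset ℕ} {f : ℕ → ℝ≥0} {b e : ℕ} {g W : ℝ≥0}
    (hs : ∀ t ∈ s, b ≤ t ∧ t ≤ e) (hW : ∀ t ∈ s, f t ≤ W)
    (h : ∀ t₁ ∈ s, ∀ t₂ ∈ s, t₁ < t₂ → f t₁ ≤ g * ((t₂ - t₁ : ℕ) : ℝ≥0)) :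
    ∑ t ∈ s, f t ≤ W + g * ((e - b : ℕ) : ℝ≥0) := by
  induction s using Finset.induction_on_max with
  | empty => simp
  | insert a s ha _ =>
    rw [Finset.sum_insert fun h => (ha a h).false]
    refine add_le_add (hW a (by simp)) ?_
    have h1 := sum_le_of_le_sub_right (s := s) (f := f) (b := b) (e := a) (g := g)
      (fun t ht => ⟨(hs t (Finset.mem_insert_of_mem ht)).1, ha t ht⟩)
      (fun t ht => h t (Finset.mem_insert_of_mem ht) a (by simp) (ha t ht))
      (fun t₁ h₁ t₂ h₂ => h t₁ (Finset.mem_insert_of_mem h₁) t₂ (Finset.mem_insert_of_mem h₂))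
    refine h1.trans ?_
    gcongr
    exact (hs a (by simp)).2

/-- The cap `2 ^ j` accounts for the last `p` terms, and the rest is a geometric series of sum at
most `2 ^ j`. In the induction, raising `p` by one shifts the index and adds one capped term. -/
theorem sum_range_min_two_pow_le (p j : ℕ) :
    ∑ i ∈ Finset.range j, min (2 ^ j) (2 ^ (p + i)) ≤ (p + 1) * 2 ^ j := by
  induction p with
  | zero =>
    calc _ ≤ ∑ i ∈ Finset.range j, 2 ^ i := Finset.sum_le_sum fun i _ => by simp
      _ ≤ (0 + 1) * 2 ^ j := by
        rw [Nat.geomSum_eq (le_refl 2)]; simp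
  | succ p ih =>
    have h1 : ∑ i ∈ Finset.range j, min (2 ^ j) (2 ^ (p + 1 + i)) ≤
        ∑ i ∈ Finset.range (j + 1), min (2 ^ j) (2 ^ (p + i)) := by
      rw [Finset.sum_range_succ']
      refine le_trans (le_of_eq ?_) (Nat.le_add_right _ _)
      exact Finset.sum_congr rfl fun i _ => by rw [show p + 1 + i = p + (i + 1) by ring]
    rw [Finset.sum_range_succ] at h1
    have h2 : min (2 ^ j) (2 ^ (p + j)) ≤ 2 ^ j := min_le_left _ _
    linarith

end Telescope

/-! ### The merged components and their weight -/

section Merged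

variable {I : Input α}

theorem merged_succ (t : ℕ) :
    merged I (t + 1) = if 2 ≤ (light I t).card then (light I t).biUnion id else ∅ := rfl

theorem exists_mem_light {t : ℕ} {x : α} (hx : x ∈ merged I t) :
    ∃ s, t = s + 1 ∧ ∃ D ∈ light I s, x ∈ D ∧ D ⊆ merged I t := by
  cases t with
  | zero => simp [merged] at hx
  | succ s =>
    refine ⟨s, rfl, ?_⟩
    rw [merged_succ] at hx ⊢
    split_ifs at hx ⊢ with h
    · obtain ⟨D, hD, hxD⟩ := Finset.mem_biUnion.1 hx
      exact ⟨D, hD, hxD, Finset.subset_biUnion_of_mem id hD⟩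
    · simp at hx

theorem merged_mem_cover {t : ℕ} (h : (merged I t).Nonempty) :
    merged I t ∈ adaptiveBinaryCover I t := by
  cases t with
  | zero => simp [merged] at h
  | succ s =>
    rw [cover_succ]
    rw [merged_succ] at h ⊢
    split_ifs at h ⊢ with hc
    · exact Finset.mem_insert_self _ _
    · simp at h

/-- Components only grow, so the light component through which `x` enters the merge contains all of
`S`. It cannot be the fresh insertion, since `x` was inserted earlier. -/
theorem weight_le_and_subset_merged {v t : ℕ} (hvt : v < t) (ht : t ≤ I.n) {S : Finset α} {x : α}
    (hS : S ∈ adaptiveBinaryCover I v) (hxS : x ∈ S) (hx : x ∈ merged I t) :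
    I.weight S ≤ (capacity t : ℝ≥0) ∧ S ⊆ merged I t := by
  obtain ⟨s, rfl, D, hD, hxD, hDm⟩ := exists_mem_light hx
  obtain ⟨hDa, hDw⟩ := mem_light.1 hD
  have hSD : S ⊆ D := by
    rcases mem_available.1 hDa with h | ⟨-, rfl⟩
    · exact subset_of_mem_cover (by omega) (by omega) hS h hxS hxD
    · have h1 : x ∈ I.inserted s := I.inserted_mono (by omega) (subset_inserted hS hxS)
      exact absurd hxD (Finset.disjoint_left.1 (I.disjoint_inserted_ins ht) h1)
  exact ⟨(I.weight_mono hSD).trans hDw, hSD.trans hDm⟩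

theorem sum_pair_le {ι : Type*} [DecidableEq ι] (f : ι → ℝ≥0) (a b : ι) :
    ∑ i ∈ ({a, b} : Finset ι), f i ≤ f a + f b := by
  rcases eq_or_ne a b with rfl | h
  · simp
  · rw [Finset.sum_pair h]

theorem buildCost_le (I : Input α) (s : ℕ) :
    I.buildCost (adaptiveBinaryCover I) (s + 1) ≤
      I.weight (I.ins (s + 1)) + I.weight (merged I (s + 1)) := by
  refine le_trans (Finset.sum_le_sum_of_subset (t := {I.ins (s + 1), merged I (s + 1)}) ?_)
    (sum_pair_le _ _ _)
  intro S hS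
  rw [Nat.add_sub_cancel, Finset.mem_sdiff, cover_succ] at hS
  have key : S ∈ available I s → S ∈ ({I.ins (s + 1), merged I (s + 1)} : Finset _) := by
    intro h
    rcases mem_available.1 h with h | h
    · exact absurd h hS.2
    · simp [h.2]
  split_ifs at hS with hc
  · rcases Finset.mem_insert.1 hS.1 with h | h
    · simp [merged_succ, hc, h]
    · exact key (Finset.sdiff_subset h)
  · exact key hS.1

/-- Merging never raises the number of components; only non-empty insertions do. -/
theorem card_cover_le (I : Input α) (t : ℕ) :
    (adaptiveBinaryCover I t).card ≤
        ((Finset.Icc 1 t).filter fun i => (I.ins i).Nonempty).card ∧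
      (available I t).card ≤
        ((Finset.Icc 1 (t + 1)).filter fun i => (I.ins i).Nonempty).card := by
  have key : ∀ t, (adaptiveBinaryCover I t).card ≤
        ((Finset.Icc 1 t).filter fun i => (I.ins i).Nonempty).card →
      (available I t).card ≤
        ((Finset.Icc 1 (t + 1)).filter fun i => (I.ins i).Nonempty).card := by
    intro t h
    rw [← Finset.insert_Icc_right_eq_Icc_add_one (by omega), Finset.filter_insert]
    unfold available addComponent
    by_cases h1 : (I.ins (t + 1)).Nonempty
    · rw [if_pos h1, if_pos h1, Finset.card_insert_of_notMem (s := Finset.filter _ _) (by simp)]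
      exact (Finset.card_insert_le _ _).trans (by omega)
    · rwa [if_neg h1, if_neg h1]
  suffices h : (adaptiveBinaryCover I t).card ≤
        ((Finset.Icc 1 t).filter fun i => (I.ins i).Nonempty).card from ⟨h, key t h⟩
  induction t with
  | zero => simp [adaptiveBinaryCover]
  | succ t ih =>
    refine le_trans ?_ (key t ih)
    rw [cover_succ]
    split_ifs with h1
    · refine (Finset.card_insert_le _ _).trans ?_
      rw [Finset.card_sdiff_of_subset (light_subset t)]
      have := Finset.card_le_card (light_subset (I := I) t)
      omega
    · exact le_rfl

theorem weight_merged_le {t : ℕ} (ht : t ≤ I.n) :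
    I.weight (merged I t) ≤ I.numInsertions * (capacity t : ℝ≥0) := by
  cases t with
  | zero => simp [merged, Input.weight]
  | succ s =>
    rw [merged_succ]
    split_ifs with h
    · refine (I.weight_biUnion_le _ _).trans ((Finset.sum_le_card_nsmul _ _ _
        fun S hS => (mem_light.1 hS).2).trans ?_)
      rw [nsmul_eq_mul]
      gcongr
      refine (Finset.card_le_card (light_subset s)).trans ((card_cover_le I s).2.trans ?_)
      exact Finset.card_le_card (Finset.filter_subset_filter _ (Finset.Icc_subset_Icc_right ht))
    · simp [Input.weight]

end Merged

/-! ### Late merges -/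

section Late

variable {I : Input α} {A : Finset α} {b : ℕ}

/-- Items that are merged at times `s` and `t` with `capacity s ≤ capacity t` are in the same
component at any earlier time `v` divisible by `capacity t`. -/
theorem eq_of_mem_merged {s t v : ℕ} (hs : s ≤ I.n)
    (ht : t ≤ I.n) (hvs : v < s) (hvt : v < t) (hst : capacity s ≤ capacity t)
    (hv : capacity t ∣ v) {S T : Finset α}
    {x y : α} (hx : x ∈ A ∩ merged I t) (hy : y ∈ A ∩ merged I s)
    (hS : S ∈ adaptiveBinaryCover I v) (hT : T ∈ adaptiveBinaryCover I v)
    (hxS : x ∈ S) (hyT : y ∈ T) : S = T := by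
  have h1 := (weight_le_and_subset_merged hvt ht hS hxS (Finset.mem_inter.1 hx).2).1
  have h2 := (weight_le_and_subset_merged hvs hs hT hyT (Finset.mem_inter.1 hy).2).1
  have h3 : (capacity s : ℝ≥0) ≤ capacity t := by exact_mod_cast hst
  have h4 : (capacity t : ℝ≥0) = 2 ^ padicValNat 2 t := by simp [capacity]
  exact eq_of_light_of_dvd hv hS hT (h4 ▸ h1) (h4 ▸ h2.trans h3)

/-- At time `t - capacity t` a single component contains every item of `A` that is merged at `s` or
at `t`. As that component also takes part in the merge at `s`, its weight is at most `capacity s`.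
The case `s = t` gives the plain bound by `capacity t`. -/
theorem weight_inter_merged_le_capacity (hA : A ⊆ I.inserted b) {s t : ℕ} (hs : s ≤ I.n)
    (ht : t ≤ I.n) (hvs : t - capacity t < s) (hst : capacity s ≤ capacity t)
    (hbt : b + capacity t ≤ t) (h : (A ∩ merged I s).Nonempty) :
    I.weight (A ∩ merged I t) ≤ capacity s := by
  obtain ⟨y, hy⟩ := h
  have hpos := capacity_pos t
  have hins : ∀ x ∈ A, x ∈ I.inserted (t - capacity t) := fun x hx =>
    I.inserted_mono (by omega) (hA hx)
  obtain ⟨T, hT, hyT⟩ := exists_mem_cover (hins y (Finset.mem_inter.1 hy).1)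
  refine (I.weight_mono ?_).trans
    (weight_le_and_subset_merged hvs hs hT hyT (Finset.mem_inter.1 hy).2).1
  intro x hx
  obtain ⟨S, hS, hxS⟩ := exists_mem_cover (hins x (Finset.mem_inter.1 hx).1)
  have := eq_of_mem_merged hs ht hvs (by omega) hst
    (Nat.dvd_sub (capacity_dvd t) dvd_rfl) hx hy hS hT hxS hyT
  exact this ▸ hxS

/-- The total weight of the items of `A` in late merges: those at times `t` for which all
items of `A` are already present at time `t - capacity t`. -/
theorem sum_late_le (hA : A ⊆ I.inserted b) {e : ℕ} (hbe : b ≤ e) (he : e ≤ I.n) :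
    ∑ t ∈ (Finset.Icc b e).filter (fun t => b + capacity t ≤ t), I.weight (A ∩ merged I t) ≤
      ((e - b : ℕ) : ℝ≥0) := by
  set s := (Finset.Icc b e).filter (fun t => b + capacity t ≤ t) with hs
  have hmem : ∀ t ∈ s, b ≤ t ∧ t ≤ e ∧ b + capacity t ≤ t := by
    intro t ht
    simpa [hs, and_assoc] using ht
  rw [← Finset.sum_filter_of_ne (p := fun t => (A ∩ merged I t).Nonempty)]
  · refine sum_le_of_le_sub_left hbe ?_ ?_ ?_
    · intro t ht
      exact (hmem t (Finset.filter_subset _ _ ht)).2.1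
    · intro t ht
      obtain ⟨ht, hne⟩ := Finset.mem_filter.1 ht
      obtain ⟨h1, h2, h3⟩ := hmem t ht
      have := capacity_pos t
      refine ⟨h1, (weight_inter_merged_le_capacity hA (s := t) (by omega) (by omega)
        (by omega) le_rfl h3 hne).trans ?_⟩
      exact_mod_cast (by omega)
    · intro t₁ h₁ t₂ h₂ hlt
      obtain ⟨h₁, hne₁⟩ := Finset.mem_filter.1 h₁
      obtain ⟨h₂, hne₂⟩ := Finset.mem_filter.1 h₂
      obtain ⟨-, -, -⟩ := hmem t₁ h₁
      obtain ⟨-, h5, h6⟩ := hmem t₂ h₂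
      have hpos := capacity_pos t₂
      -- If `t₁` falls in the window of length `capacity t₂` before `t₂`, its smaller capacity
      -- bounds the merge at `t₂` and is at most the gap; otherwise `capacity t₂` is itself at most
      -- the gap.
      by_cases hd : t₂ < t₁ + capacity t₂
      · have hc := capacity_lt_capacity hlt hd
        refine (weight_inter_merged_le_capacity hA (s := t₁) (by omega) (by omega)
          (by omega) hc.le h6 hne₁).trans ?_
        exact_mod_cast capacity_le_sub hlt hc.le
      · refine (weight_inter_merged_le_capacity hA (s := t₂) (by omega) (by omega)
          (by omega) le_rfl h6 hne₂).trans ?_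
        exact_mod_cast (by omega)
  · intro t _ h
    by_contra h'
    rw [Finset.not_nonempty_iff_eq_empty] at h'
    simp [h', Input.weight] at h

end Late

/-! ### Early merges and heights -/

section Early

/-- The times `t` in `[b, e]` for which `b` is one of the last `capacity t` times up to `t`. -/
def earlyTimes (b e : ℕ) : Finset ℕ := (Finset.Icc b e).filter fun t => t < b + capacity t

/-- The number of early merges before time `t` in which the item `x` takes part. -/
noncomputable def height (I : Input α) (b e t : ℕ) (x : α) : ℕ :=
  ((earlyTimes b e).filter fun s => s < t ∧ x ∈ merged I s).card

/-- The items of `A` that are merged at time `t` and have height at least `k`. -/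
noncomputable def deepItems (I : Input α) (A : Finset α) (b e k t : ℕ) : Finset α :=
  (A ∩ merged I t).filter fun x => k ≤ height I b e t x

/-- The factor by which the weight of the items of height `k` in a merge exceeds its capacity. -/
def loadFactor (m k : ℕ) : ℕ := (fun g => Nat.clog 2 g + 1)^[k] m

theorem loadFactor_succ (m k : ℕ) :
    loadFactor m (k + 1) = Nat.clog 2 (loadFactor m k) + 1 :=
  Function.iterate_succ_apply' _ _ _

variable {I : Input α} {A : Finset α} {b e : ℕ}

theorem mem_earlyTimes {t : ℕ} :
    t ∈ earlyTimes b e ↔ (b ≤ t ∧ t ≤ e) ∧ t < b + capacity t := by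
  simp [earlyTimes]

theorem capacity_lt_of_mem_earlyTimes {s t : ℕ} (hs : s ∈ earlyTimes b e)
    (ht : t ∈ earlyTimes b e) (hst : s < t) : capacity s < capacity t := by
  rw [mem_earlyTimes] at hs ht
  exact capacity_lt_capacity hst (by omega)

theorem padicValNat_lt_of_mem_earlyTimes {s t : ℕ} (hs : s ∈ earlyTimes b e)
    (ht : t ∈ earlyTimes b e) (hst : s < t) : padicValNat 2 s < padicValNat 2 t :=
  (Nat.pow_lt_pow_iff_right (by norm_num)).1 (capacity_lt_of_mem_earlyTimes hs ht hst)

theorem height_lt_height {s t : ℕ} {x : α} (hs : s ∈ earlyTimes b e) (hst : s < t)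
    (hx : x ∈ merged I s) : height I b e s x < height I b e t x := by
  refine Finset.card_lt_card (Finset.ssubset_iff_of_subset ?_ |>.2 ⟨s, ?_, ?_⟩)
  · intro r hr
    simp only [Finset.mem_filter] at hr ⊢
    exact ⟨hr.1, hr.2.1.trans hst, hr.2.2⟩
  · simp [hs, hst, hx]
  · simp

theorem exists_mem_deepItems {k t : ℕ} {x : α} (hx : x ∈ deepItems I A b e (k + 1) t) :
    ∃ s ∈ earlyTimes b e, s < t ∧ x ∈ deepItems I A b e k s := by
  obtain ⟨hxA, hk⟩ := Finset.mem_filter.1 hx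
  set F := (earlyTimes b e).filter fun s => s < t ∧ x ∈ merged I s with hF
  have hk' : k + 1 ≤ F.card := hk
  have hne : F.Nonempty := Finset.card_pos.1 (by omega)
  have hmax := F.max'_mem hne
  obtain ⟨h1, h2, h3⟩ := Finset.mem_filter.1 hmax
  refine ⟨F.max' hne, h1, h2, Finset.mem_filter.2 ⟨Finset.mem_inter.2
    ⟨(Finset.mem_inter.1 hxA).1, h3⟩, ?_⟩⟩
  have h4 : k ≤ (F.erase (F.max' hne)).card := by
    rw [Finset.card_erase_of_mem hmax]; omega
  refine h4.trans (Finset.card_le_card fun r hr => ?_)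
  obtain ⟨hr1, hr2⟩ := Finset.mem_erase.1 hr
  obtain ⟨hr3, -, hr4⟩ := Finset.mem_filter.1 hr2
  exact Finset.mem_filter.2 ⟨hr3, lt_of_le_of_ne (F.le_max' r hr2) hr1, hr4⟩

/-- Early times before `t` have pairwise distinct 2-adic valuations, all below that of `t`, so the
sum is dominated by the capped geometric series with `p = Nat.clog 2 g`. -/
theorem sum_min_capacity_le (g : ℕ) {t : ℕ} (ht : t ∈ earlyTimes b e) :
    ∑ s ∈ (earlyTimes b e).filter (· < t), min (capacity t) (g * capacity s) ≤
      (Nat.clog 2 g + 1) * capacity t := by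
  refine le_trans ?_ (sum_range_min_two_pow_le (Nat.clog 2 g) (padicValNat 2 t))
  set F := (earlyTimes b e).filter (· < t) with hF
  have hinj : Set.InjOn (padicValNat 2) F := by
    intro s hs s' hs' h
    have hs := (Finset.mem_filter.1 hs).1
    have hs' := (Finset.mem_filter.1 hs').1
    rcases lt_trichotomy s s' with h1 | h1 | h1
    · exact absurd h (padicValNat_lt_of_mem_earlyTimes hs hs' h1).ne
    · exact h1
    · exact absurd h (padicValNat_lt_of_mem_earlyTimes hs' hs h1).ne'
  calc _ ≤ ∑ s ∈ F, min (2 ^ padicValNat 2 t) (2 ^ (Nat.clog 2 g + padicValNat 2 s)) := by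
        refine Finset.sum_le_sum fun s _ => min_le_min le_rfl ?_
        rw [pow_add]
        exact Nat.mul_le_mul_right _ (Nat.le_pow_clog (by norm_num) g)
    _ = ∑ i ∈ F.image (padicValNat 2),
          min (2 ^ padicValNat 2 t) (2 ^ (Nat.clog 2 g + i)) := by
        rw [Finset.sum_image hinj]
    _ ≤ _ := by
        refine Finset.sum_le_sum_of_subset fun i hi => ?_
        obtain ⟨s, hs, rfl⟩ := Finset.mem_image.1 hi
        obtain ⟨h1, h2⟩ := Finset.mem_filter.1 hs
        exact Finset.mem_range.2 (padicValNat_lt_of_mem_earlyTimes h1 ht h2)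

/-- An item of height at least `k + 1` had height at least `k` in its previous early merge, so the
load at `t` is inherited from earlier early times, which have smaller capacities. This turns a load
factor `g` into `Nat.clog 2 g + 1`. Initially the factor is the number of insertions, which bounds
the number of components merged. -/
theorem weight_deepItems_le (he : e ≤ I.n) (k : ℕ) {t : ℕ} (ht : t ∈ earlyTimes b e) :
    I.weight (deepItems I A b e k t) ≤
      ((loadFactor I.numInsertions k * capacity t : ℕ) : ℝ≥0) := by
  induction k generalizing t with
  | zero =>
    refine (I.weight_mono ((Finset.filter_subset _ _).trans Finset.inter_subset_right)).trans
      ((weight_merged_le ((mem_earlyTimes.1 ht).1.2.trans he)).trans ?_)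
    simp [loadFactor]
  | succ k ih =>
    have hsub : deepItems I A b e (k + 1) t ⊆ ((earlyTimes b e).filter (· < t)).biUnion
        fun s => deepItems I A b e k s ∩ merged I t := by
      intro x hx
      obtain ⟨s, hs, hst, hxs⟩ := exists_mem_deepItems hx
      exact Finset.mem_biUnion.2 ⟨s, Finset.mem_filter.2 ⟨hs, hst⟩, Finset.mem_inter.2
        ⟨hxs, (Finset.mem_inter.1 (Finset.mem_filter.1 hx).1).2⟩⟩
    have h1 : ∀ s ∈ (earlyTimes b e).filter (· < t),
        I.weight (deepItems I A b e k s ∩ merged I t) ≤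
          ((min (capacity t) (loadFactor I.numInsertions k * capacity s) : ℕ) : ℝ≥0) := by
      intro s hs
      obtain ⟨hs, hst⟩ := Finset.mem_filter.1 hs
      rw [Nat.cast_min]
      -- The second bound is the induction hypothesis at `s`. For the first, if anything merged at
      -- `s` is merged again at `t`, then the whole component built at `s` has weight at most
      -- `capacity t`.
      refine le_min ?_ ((I.weight_mono Finset.inter_subset_left).trans (ih hs))
      rcases (deepItems I A b e k s ∩ merged I t).eq_empty_or_nonempty with h | ⟨x, hx⟩
      · simp [h, Input.weight]
      · obtain ⟨hx1, hx2⟩ := Finset.mem_inter.1 hx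
        have hx3 := (Finset.mem_inter.1 (Finset.mem_filter.1 hx1).1).2
        refine (I.weight_mono (Finset.inter_subset_left.trans ((Finset.filter_subset _ _).trans
          Finset.inter_subset_right))).trans (weight_le_and_subset_merged hst
            ((mem_earlyTimes.1 ht).1.2.trans he) (merged_mem_cover ⟨x, hx3⟩) hx3 hx2).1
    refine (I.weight_mono hsub).trans ((I.weight_biUnion_le _ _).trans
      ((Finset.sum_le_sum h1).trans ?_))
    rw [← Nat.cast_sum, loadFactor_succ]
    exact_mod_cast sum_min_capacity_le _ ht

/-- The height of an item strictly increases with each early merge of it, so each item is counted at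
most once for every height below `L`. -/
theorem sum_shallow_le (L : ℕ) :
    ∑ t ∈ earlyTimes b e, I.weight ((A ∩ merged I t).filter fun x => ¬ L ≤ height I b e t x) ≤
      L * I.weight A := by
  have h1 : ∀ t, I.weight ((A ∩ merged I t).filter fun x => ¬ L ≤ height I b e t x) =
      ∑ x ∈ A, if x ∈ merged I t ∧ height I b e t x < L then I.wt x else 0 := by
    intro t
    rw [← Finset.sum_filter, Input.weight]
    congr 1
    ext x
    simp [and_assoc]
  simp_rw [h1]
  rw [Finset.sum_comm, Input.weight, Finset.mul_sum]
  refine Finset.sum_le_sum fun x _ => ?_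
  rw [← Finset.sum_filter, Finset.sum_const, nsmul_eq_mul]
  gcongr
  rw [← Finset.card_range L]
  refine Finset.card_le_card_of_injOn (fun t => height I b e t x) ?_ ?_
  · intro t ht
    simp only [Finset.coe_filter, Set.mem_ofPred_eq] at ht
    simpa using ht.2.2
  · intro s hs t ht h
    simp only [Finset.coe_filter, Set.mem_ofPred_eq] at hs ht
    rcases lt_trichotomy s t with h1 | h1 | h1
    · exact absurd h (height_lt_height hs.1 h1 hs.2.1).ne
    · exact h1
    · exact absurd h (height_lt_height ht.1 h1 ht.2.1).ne'

/-- The shallow items cost `L` times the weight of `A`. The deep load at an early time is at most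
the load factor times the gap to the next early time, and at the last early time it is at most the
weight of `A`; hence `L + 1`. -/
theorem sum_early_le (he : e ≤ I.n) (L : ℕ) :
    ∑ t ∈ earlyTimes b e, I.weight (A ∩ merged I t) ≤
      (L + 1) * I.weight A + loadFactor I.numInsertions L * ((e - b : ℕ) : ℝ≥0) := by
  have h1 : ∀ t, I.weight (A ∩ merged I t) =
      I.weight ((A ∩ merged I t).filter fun x => ¬ L ≤ height I b e t x) +
        I.weight (deepItems I A b e L t) := fun _ => by
    rw [add_comm]
    exact (Finset.sum_filter_add_sum_filter_not _ _ _).symm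
  simp_rw [h1]
  rw [Finset.sum_add_distrib, add_mul, one_mul, add_assoc]
  refine add_le_add (sum_shallow_le L) (sum_le_add_of_le_sub_right
    (fun t ht => (mem_earlyTimes.1 ht).1) (fun _ _ => I.weight_mono
      ((Finset.filter_subset _ _).trans Finset.inter_subset_left)) ?_)
  intro s hs t ht hst
  refine (weight_deepItems_le he L hs).trans ?_
  rw [Nat.cast_mul]
  gcongr
  exact capacity_le_sub hst (capacity_lt_of_mem_earlyTimes hs ht hst).le

theorem sum_inter_merged_le (hA : A ⊆ I.inserted b) (hbe : b ≤ e) (he : e ≤ I.n) (L : ℕ) :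
    ∑ t ∈ Finset.Icc b e, I.weight (A ∩ merged I t) ≤
      (L + 1) * I.weight A + (loadFactor I.numInsertions L + 1) * ((e - b : ℕ) : ℝ≥0) := by
  rw [← Finset.sum_filter_add_sum_filter_not _ (fun t => t < b + capacity t)]
  simp_rw [not_lt]
  refine (add_le_add (sum_early_le he L) (sum_late_le hA hbe he)).trans (le_of_eq ?_)
  ring

end Early

/-! ### Build cost: charging merges to the runs of a reference solution -/

section Runs

variable {C : ℕ → Finset (Finset α)}

/-- The times from `b` on during which `S` stays in the cover. -/
def run (C : ℕ → Finset (Finset α)) (n b : ℕ) (S : Finset α) : Finset ℕ :=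
  (Finset.Icc b n).filter fun t => ∀ τ ∈ Finset.Icc b t, S ∈ C τ

theorem exists_start (h0 : C 0 = ∅) {t : ℕ} {S : Finset α} (hS : S ∈ C t) :
    ∃ b, 1 ≤ b ∧ b ≤ t ∧ S ∈ C b \ C (b - 1) ∧ ∀ τ ∈ Finset.Icc b t, S ∈ C τ := by
  induction t with
  | zero => simp [h0] at hS
  | succ t ih =>
    by_cases h : S ∈ C t
    · obtain ⟨b, h1, h2, h3, h4⟩ := ih h
      refine ⟨b, h1, by omega, h3, fun τ hτ => ?_⟩
      rw [Finset.mem_Icc] at hτ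
      rcases hτ.2.eq_or_lt with rfl | h5
      · exact hS
      · exact h4 τ (Finset.mem_Icc.2 ⟨hτ.1, by omega⟩)
    · refine ⟨t + 1, by omega, le_rfl, Finset.mem_sdiff.2 ⟨hS, by simpa using h⟩, ?_⟩
      intro τ hτ
      rw [Finset.mem_Icc] at hτ
      rwa [show τ = t + 1 by omega]

/-- Every pair of a time and a component of the cover at that time belongs to exactly one maximal
stay, found by going back to the last time the component was new. -/
theorem sum_runs (h0 : C 0 = ∅) (n : ℕ) (F : ℕ → Finset α → ℝ≥0) :
    ∑ b ∈ Finset.Icc 1 n, ∑ S ∈ C b \ C (b - 1), ∑ t ∈ run C n b S, F t S =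
      ∑ t ∈ Finset.Icc 1 n, ∑ S ∈ C t, F t S := by
  simp_rw [Finset.sum_sigma']
  refine Finset.sum_bij (fun p _ => ⟨p.2.2, p.2.1⟩) ?_ ?_ ?_ ?_
  · rintro ⟨b, S, t⟩ hp
    simp only [Finset.mem_sigma, run, Finset.mem_filter, Finset.mem_Icc] at hp ⊢
    exact ⟨by omega, hp.2.2.2 t ⟨hp.2.2.1.1, le_rfl⟩⟩
  · rintro ⟨b, S, t⟩ hp ⟨b', S', t'⟩ hp' h
    simp only [Sigma.mk.injEq, heq_eq_eq] at h
    obtain ⟨rfl, rfl⟩ := h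
    simp only [Finset.mem_sigma, run, Finset.mem_filter, Finset.mem_Icc,
      Finset.mem_sdiff] at hp hp'
    have hbb : b = b' := by
      rcases lt_trichotomy b b' with h | h | h
      · exact absurd (hp.2.2.2 (b' - 1) (by omega)) hp'.2.1.2
      · exact h
      · exact absurd (hp'.2.2.2 (b - 1) (by omega)) hp.2.1.2
    subst hbb
    rfl
  · rintro ⟨t, S⟩ hp
    simp only [Finset.mem_sigma, Finset.mem_Icc] at hp
    obtain ⟨b, h1, h2, h3, h4⟩ := exists_start h0 hp.2
    refine ⟨⟨b, S, t⟩, ?_, rfl⟩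
    simp only [Finset.mem_sigma, run, Finset.mem_filter, Finset.mem_Icc] at h4 ⊢
    exact ⟨by omega, h3, by omega, h4⟩
  · rintro ⟨b, S, t⟩ _
    rfl

variable {I : Input α}

theorem sum_run_inter_merged_le {n b : ℕ} {S : Finset α} (hn : n ≤ I.n) (hb : b ≤ n)
    (hS : S ∈ C b) (hA : S ⊆ I.inserted b) (L : ℕ) :
    ∑ t ∈ run C n b S, I.weight (S ∩ merged I t) ≤
      (L + 1) * I.weight S + (loadFactor I.numInsertions L + 1) * ∑ _t ∈ run C n b S, 1 := by
  have hbr : b ∈ run C n b S := by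
    simp only [run, Finset.mem_filter, Finset.mem_Icc]
    exact ⟨⟨le_rfl, hb⟩, fun τ hτ => by rwa [show τ = b by omega]⟩
  set e := (run C n b S).max' ⟨b, hbr⟩ with he
  have hmem : e ∈ run C n b S := Finset.max'_mem _ _
  have hbe : b ≤ e := Finset.le_max' _ _ hbr
  have hen : e ≤ n := (Finset.mem_Icc.1 (Finset.filter_subset _ _ hmem)).2
  have hrun : run C n b S = Finset.Icc b e := by
    ext t
    constructor
    · intro ht
      exact Finset.mem_Icc.2 ⟨(Finset.mem_Icc.1 (Finset.filter_subset _ _ ht)).1,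
        Finset.le_max' _ _ ht⟩
    · intro ht
      rw [Finset.mem_Icc] at ht
      simp only [run, Finset.mem_filter, Finset.mem_Icc] at hmem ⊢
      exact ⟨by omega, fun τ hτ => hmem.2 τ (by omega)⟩
  rw [hrun]
  refine (sum_inter_merged_le hA hbe (hen.trans hn) L).trans ?_
  gcongr
  simp only [Finset.sum_const, Nat.card_Icc, nsmul_eq_mul, mul_one]
  exact_mod_cast (by omega)

/-- The total weight of all merges, compared to the cost of an arbitrary solution. -/
theorem sum_weight_merged_le (hC : I.IsSolution C) (L : ℕ) :
    ∑ t ∈ Finset.Icc 1 I.n, I.weight (merged I t) ≤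
      (L + 1) * ∑ t ∈ Finset.Icc 1 I.n, I.buildCost C t +
        (loadFactor I.numInsertions L + 1) *
          ∑ t ∈ Finset.Icc 1 I.n, (Input.queryCost C t : ℝ≥0) := by
  have h1 : ∀ t ∈ Finset.Icc 1 I.n, I.weight (merged I t) ≤
      ∑ S ∈ C t, I.weight (S ∩ merged I t) := by
    intro t ht
    refine (I.weight_mono fun x hx => ?_).trans (I.weight_biUnion_le _ _)
    have h2 : x ∈ (C t).biUnion id := by
      rw [hC.cover t ht]
      exact subset_inserted (merged_mem_cover ⟨x, hx⟩) hx
    obtain ⟨S, hS, hxS⟩ := Finset.mem_biUnion.1 h2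
    exact Finset.mem_biUnion.2 ⟨S, hS, Finset.mem_inter.2 ⟨hxS, hx⟩⟩
  have h3 : ∀ t, (Input.queryCost C t : ℝ≥0) = ∑ S ∈ C t, 1 := by simp [Input.queryCost]
  refine (Finset.sum_le_sum h1).trans ?_
  simp_rw [h3]
  -- Regrouped by runs, the claim reduces to comparing the merges inside each run with its build
  -- weight and its length.
  rw [← sum_runs hC.zero, ← sum_runs hC.zero]
  simp only [Input.buildCost, Finset.mul_sum]
  simp only [← Finset.sum_add_distrib]
  refine Finset.sum_le_sum fun b hb => Finset.sum_le_sum fun S hS => ?_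
  rw [Finset.mem_Icc] at hb
  have hSb := (Finset.mem_sdiff.1 hS).1
  refine (sum_run_inter_merged_le le_rfl hb.2 hSb ?_ L).trans ?_
  · rw [← hC.cover b (Finset.mem_Icc.2 hb)]
    exact Finset.subset_biUnion_of_mem id hSb
  · rw [Finset.mul_sum]

/-- The total weight of all items is at most the build cost of any solution. -/
theorem sum_weight_ins_le (hC : I.IsSolution C) :
    ∑ t ∈ Finset.Icc 1 I.n, I.weight (I.ins t) ≤ ∑ t ∈ Finset.Icc 1 I.n, I.buildCost C t := by
  refine Finset.sum_le_sum fun t ht => ?_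
  refine (I.weight_mono (T := (C t \ C (t - 1)).biUnion id) ?_).trans (I.weight_biUnion_le _ _)
  intro x hx
  have hx' : x ∈ (C t).biUnion id := by
    rw [hC.cover t ht]
    exact Finset.mem_biUnion.2 ⟨t, Finset.mem_Icc.2 ⟨(Finset.mem_Icc.1 ht).1, le_rfl⟩, hx⟩
  obtain ⟨S, hS, hxS⟩ := Finset.mem_biUnion.1 hx'
  refine Finset.mem_biUnion.2 ⟨S, Finset.mem_sdiff.2 ⟨hS, fun h => ?_⟩, hxS⟩
  rw [Finset.mem_Icc] at ht
  rcases eq_or_ne t 1 with rfl | h1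
  · simp [hC.zero] at h
  · have h2 : x ∈ I.inserted (t - 1) := by
      rw [← hC.cover (t - 1) (Finset.mem_Icc.2 (by omega))]
      exact Finset.mem_biUnion.2 ⟨S, h, hxS⟩
    obtain ⟨s, rfl⟩ : ∃ s, t = s + 1 := ⟨t - 1, by omega⟩
    exact Finset.disjoint_left.1 (I.disjoint_inserted_ins ht.2) h2 hx

theorem sum_buildCost_le (hC : I.IsSolution C) (L : ℕ) :
    ∑ t ∈ Finset.Icc 1 I.n, I.buildCost (adaptiveBinaryCover I) t ≤
      (L + 2) * ∑ t ∈ Finset.Icc 1 I.n, I.buildCost C t +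
        (loadFactor I.numInsertions L + 1) *
          ∑ t ∈ Finset.Icc 1 I.n, (Input.queryCost C t : ℝ≥0) := by
  have h1 : ∀ t ∈ Finset.Icc 1 I.n, I.buildCost (adaptiveBinaryCover I) t ≤
      I.weight (I.ins t) + I.weight (merged I t) := by
    intro t ht
    obtain ⟨s, rfl⟩ : ∃ s, t = s + 1 := ⟨t - 1, by rw [Finset.mem_Icc] at ht; omega⟩
    exact buildCost_le I s
  refine (Finset.sum_le_sum h1).trans ?_
  rw [Finset.sum_add_distrib]
  refine (add_le_add (sum_weight_ins_le hC) (sum_weight_merged_le hC L)).trans (le_of_eq ?_)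
  ring

end Runs

/-! ### Query cost: charging blocks of time to built components -/

section Query

/-- The least exponent `r` such that the weight of `S` is at most `2 ^ r`. -/
noncomputable def rank (I : Input α) (S : Finset α) : ℕ := Nat.clog 2 ⌈I.weight S⌉₊

/-- All components that are part of the cover at some time. -/
noncomputable def allComponents (I : Input α) : Finset (Finset α) :=
  (Finset.Icc 1 I.n).biUnion (adaptiveBinaryCover I)

/-- The components at time `t` other than the lightest one. -/
noncomputable def nonlightest (I : Input α) (t : ℕ) : Finset (Finset α) :=
  (adaptiveBinaryCover I t).filter fun S =>
    ∃ T ∈ adaptiveBinaryCover I t, T ≠ S ∧ I.weight T ≤ I.weight S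

/-- The pairs `(S, q)` such that `S` is a component other than the lightest one at some time in
the `q`-th block of length `2 ^ rank S`. -/
noncomputable def blocks (I : Input α) : Finset (Finset α × ℕ) :=
  ((Finset.Icc 1 I.n).sigma (nonlightest I)).image fun p => (p.2, p.1 / 2 ^ rank I p.2)

variable {I : Input α}

theorem rank_le_iff {S : Finset α} {r : ℕ} : rank I S ≤ r ↔ I.weight S ≤ 2 ^ r := by
  rw [rank, Nat.clog_le_iff_le_pow (by norm_num), Nat.ceil_le]
  norm_cast

theorem weight_le_two_pow_rank (S : Finset α) : I.weight S ≤ 2 ^ rank I S := rank_le_iff.1 le_rfl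

theorem two_pow_rank_le {S : Finset α} (h : rank I S ≠ 0) : 2 ^ rank I S ≤ 2 * I.weight S := by
  obtain ⟨r, hr⟩ := Nat.exists_eq_succ_of_ne_zero h
  have h1 : ¬ I.weight S ≤ 2 ^ r := fun h => by
    have := rank_le_iff.2 h
    omega
  rw [hr, pow_succ', not_le] at *
  gcongr

theorem sum_two_pow_range_rank_le (S : Finset α) :
    ∑ r ∈ Finset.range (rank I S), (2 : ℝ≥0) ^ r ≤ 2 * I.weight S := by
  rcases eq_or_ne (rank I S) 0 with h | h
  · simp [h]
  · refine le_trans ?_ (two_pow_rank_le h)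
    have h1 : ∑ r ∈ Finset.range (rank I S), 2 ^ r ≤ 2 ^ rank I S := by
      rw [Nat.geomSum_eq le_rfl]; simp
    exact_mod_cast h1

theorem sum_allComponents_le (I : Input α) :
    ∑ S ∈ allComponents I, I.weight S ≤
      ∑ t ∈ Finset.Icc 1 I.n, I.buildCost (adaptiveBinaryCover I) t := by
  refine le_trans (Finset.sum_le_sum_of_subset (t := (Finset.Icc 1 I.n).biUnion fun t =>
    adaptiveBinaryCover I t \ adaptiveBinaryCover I (t - 1)) ?_) (sum_biUnion_le _ _ _)
  intro S hS
  obtain ⟨t, ht, hS⟩ := Finset.mem_biUnion.1 hS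
  obtain ⟨b, h1, h2, h3, -⟩ := exists_start rfl hS
  rw [Finset.mem_Icc] at ht
  exact Finset.mem_biUnion.2 ⟨b, Finset.mem_Icc.2 (by omega), h3⟩

theorem card_cover_le_nonlightest (t : ℕ) :
    (adaptiveBinaryCover I t).card ≤
      (if (adaptiveBinaryCover I t).Nonempty then 1 else 0) + (nonlightest I t).card := by
  split_ifs with h
  · have h1 : (adaptiveBinaryCover I t \ nonlightest I t).card ≤ 1 := by
      refine Finset.card_le_one.2 fun S hS T hT => ?_
      by_contra hne
      simp only [nonlightest, Finset.mem_sdiff, Finset.mem_filter, not_and, not_exists] at hS hT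
      rcases le_total (I.weight S) (I.weight T) with h | h
      · exact hT.2 hT.1 S hS.1 hne h
      · exact hS.2 hS.1 T hT.1 (Ne.symm hne) h
    have h2 : nonlightest I t ⊆ adaptiveBinaryCover I t := Finset.filter_subset _ _
    rw [Finset.card_sdiff_of_subset h2] at h1
    omega
  · simp [Finset.not_nonempty_iff_eq_empty.1 h]

/-- Every capacity is at least 1, so two components of weight at most 1 never coexist after a time
step. -/
theorem rank_ne_zero_of_nonlightest {t : ℕ} {S : Finset α} (h : S ∈ nonlightest I t) :
    rank I S ≠ 0 := by
  intro h0
  obtain ⟨hS, T, hT, hne, hle⟩ := Finset.mem_filter.1 h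
  have h1 := rank_le_iff.1 h0.le
  exact hne (eq_of_light_of_dvd (j := 0) (one_dvd t) hT hS (hle.trans h1) h1)

theorem mem_blocks {S : Finset α} {q : ℕ} (h : (S, q) ∈ blocks I) :
    ∃ t, 1 ≤ t ∧ t ≤ I.n ∧ S ∈ nonlightest I t ∧ q * 2 ^ rank I S ≤ t ∧
      t < (q + 1) * 2 ^ rank I S := by
  obtain ⟨⟨t, S'⟩, hp, hp'⟩ := Finset.mem_image.1 h
  simp only [Prod.mk.injEq] at hp'
  obtain ⟨rfl, rfl⟩ := hp'
  simp only [Finset.mem_sigma, Finset.mem_Icc] at hp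
  exact ⟨t, hp.1.1, hp.1.2, hp.2, Nat.div_mul_le_self _ _, by
    rw [add_mul, one_mul]; exact Nat.lt_div_mul_add (by positivity)⟩

theorem sum_card_nonlightest_le (I : Input α) :
    ∑ t ∈ Finset.Icc 1 I.n, (nonlightest I t).card ≤ ∑ p ∈ blocks I, 2 ^ rank I p.1 := by
  rw [← Finset.card_sigma, Finset.card_eq_sum_card_image
    (fun p : (_ : ℕ) × Finset α => (p.2, p.1 / 2 ^ rank I p.2))]
  refine Finset.sum_le_sum fun p _ => ?_
  have h1 : 2 ^ rank I p.1 =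
      (Finset.Ico (p.2 * 2 ^ rank I p.1) ((p.2 + 1) * 2 ^ rank I p.1)).card := by
    rw [Nat.card_Ico, ← Nat.sub_mul]; simp
  rw [h1]
  refine Finset.card_le_card_of_injOn (fun x => x.1) ?_ ?_
  · rintro ⟨t, S⟩ hx
    simp only [Finset.coe_filter, Set.mem_ofPred_eq] at hx
    obtain ⟨-, rfl⟩ := hx
    simp only [Finset.coe_Ico, Set.mem_Ico]
    exact ⟨Nat.div_mul_le_self _ _, by
      rw [add_mul, one_mul]; exact Nat.lt_div_mul_add (by positivity)⟩
  · rintro ⟨t, S⟩ hx ⟨t', S'⟩ hx' h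
    simp only [Finset.coe_filter, Set.mem_ofPred_eq] at hx hx' h
    obtain ⟨-, rfl⟩ := hx
    have := congrArg Prod.fst hx'.2
    simp only at this
    subst h this
    rfl

/-- A family of blocks that contains at most one block for each component. -/
theorem sum_two_pow_rank_le_of_unique {B : Finset (Finset α × ℕ)} (hB : B ⊆ blocks I)
    (h : ∀ S q q', (S, q) ∈ B → (S, q') ∈ B → ¬ q < q') :
    ∑ p ∈ B, (2 : ℝ≥0) ^ rank I p.1 ≤ 2 * ∑ S ∈ allComponents I, I.weight S := by
  have hinj : Set.InjOn Prod.fst (B : Set (Finset α × ℕ)) := by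
    rintro ⟨S, q⟩ h1 ⟨S', q'⟩ h2 rfl
    rcases lt_trichotomy q q' with h3 | h3 | h3
    · exact absurd h3 (h _ _ _ h1 h2)
    · rw [h3]
    · exact absurd h3 (h _ _ _ h2 h1)
  calc _ ≤ ∑ p ∈ B, 2 * I.weight p.1 := Finset.sum_le_sum fun p hp => by
        obtain ⟨t, -, -, h1, -⟩ := mem_blocks (hB hp)
        exact two_pow_rank_le (rank_ne_zero_of_nonlightest h1)
    _ = ∑ S ∈ B.image Prod.fst, 2 * I.weight S := by rw [Finset.sum_image hinj]
    _ ≤ ∑ S ∈ allComponents I, 2 * I.weight S := by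
        refine Finset.sum_le_sum_of_subset fun S hS => ?_
        obtain ⟨⟨S', q⟩, hp, rfl⟩ := Finset.mem_image.1 hS
        obtain ⟨t, h1, h2, h3, -⟩ := mem_blocks (hB hp)
        exact Finset.mem_biUnion.2 ⟨t, Finset.mem_Icc.2 ⟨h1, h2⟩, (Finset.mem_filter.1 h3).1⟩
    _ = _ := by rw [Finset.mul_sum]

/-- If a component `S` survives a block, and is not always the lightest one there, then a
component heavier than `2 ^ rank S` is built in that block. -/
theorem exists_heavy_of_block {S : Finset α} {q : ℕ} (h : (S, q) ∈ blocks I)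
    (hn : (q + 1) * 2 ^ rank I S ≤ I.n)
    (h2 : S ∈ adaptiveBinaryCover I ((q + 1) * 2 ^ rank I S)) :
    ∃ T, T ∈ adaptiveBinaryCover I ((q + 1) * 2 ^ rank I S) ∧
      T ∉ adaptiveBinaryCover I (q * 2 ^ rank I S) ∧ rank I S < rank I T := by
  obtain ⟨t, h3, h4, h5, h6, h7⟩ := mem_blocks h
  obtain ⟨hS, T, hT, hne, hle⟩ := Finset.mem_filter.1 h5
  obtain ⟨x, hx⟩ := nonempty_of_mem_cover hT
  obtain ⟨R, hR, hTR⟩ := exists_superset h7.le hT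
  have hRS : R ≠ S := by
    rintro rfl
    exact hne (eq_of_mem_cover h4 hT hS hx (hTR hx))
  have hrank : rank I S < rank I R := by
    by_contra! h8
    exact hRS (eq_of_light_of_dvd (dvd_mul_left _ _) hR h2 (rank_le_iff.1 h8)
      (weight_le_two_pow_rank S))
  -- Had `R` existed at the start of the block, it would be present at time `t` and equal to the
  -- component `T` inside it, which is no heavier than `S`.
  refine ⟨R, hR, fun h8 => ?_, hrank⟩
  have h9 := mem_cover_of_mem_of_mem h6 h7.le hn h8 hR
  have h10 := eq_of_mem_cover h4 hT h9 hx (hTR hx)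
  subst h10
  exact absurd (rank_le_iff.2 (hle.trans (weight_le_two_pow_rank S))) (not_le.2 hrank)

/-- Charge each block to the pair of the heavier component built in it and the rank of `S`. The
charging is injective: a component is built in only one block of each length, and at the start of a
block of length `2 ^ r` only one component has weight at most `2 ^ r`. A component `T` receives at
most the sum of `2 ^ r` over `r < rank I T`, which is at most twice its weight. -/
theorem sum_survived_blocks_le {B : Finset (Finset α × ℕ)} (hB : B ⊆ blocks I)
    (h : ∀ S q, (S, q) ∈ B → (q + 1) * 2 ^ rank I S ≤ I.n ∧
      S ∈ adaptiveBinaryCover I (q * 2 ^ rank I S) ∧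
      S ∈ adaptiveBinaryCover I ((q + 1) * 2 ^ rank I S)) :
    ∑ p ∈ B, (2 : ℝ≥0) ^ rank I p.1 ≤ 2 * ∑ S ∈ allComponents I, I.weight S := by
  have hex : ∀ p : Finset α × ℕ, ∃ T, p ∈ B →
      T ∈ adaptiveBinaryCover I ((p.2 + 1) * 2 ^ rank I p.1) ∧
      T ∉ adaptiveBinaryCover I (p.2 * 2 ^ rank I p.1) ∧ rank I p.1 < rank I T := by
    rintro ⟨S, q⟩
    by_cases hp : (S, q) ∈ B
    · obtain ⟨T, hT⟩ := exists_heavy_of_block (hB hp) (h S q hp).1 (h S q hp).2.2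
      exact ⟨T, fun _ => hT⟩
    · exact ⟨∅, fun h' => absurd h' hp⟩
  choose f hf using hex
  have hlt : ∀ S q S' q', (S, q) ∈ B → (S', q') ∈ B → f (S, q) = f (S', q') →
      rank I S = rank I S' → ¬ q < q' := by
    intro S q S' q' h1 h2 h3 h4 h5
    obtain ⟨h6, -, -⟩ := hf _ h1
    obtain ⟨h7, h8, -⟩ := hf _ h2
    refine h8 (mem_cover_of_mem_of_mem ?_ ?_ (h S' q' h2).1 (h3 ▸ h6) h7)
    · simp only
      rw [h4]
      exact Nat.mul_le_mul_right _ h5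
    · exact Nat.mul_le_mul_right _ (Nat.le_succ _)
  have hinj : Set.InjOn (fun p => (⟨f p, rank I p.1⟩ : (_ : Finset α) × ℕ))
      (B : Set (Finset α × ℕ)) := by
    rintro ⟨S, q⟩ h1 ⟨S', q'⟩ h2 h3
    simp only [Sigma.mk.injEq, heq_eq_eq] at h3
    have hq : q = q' := by
      rcases lt_trichotomy q q' with h4 | h4 | h4
      · exact absurd h4 (hlt _ _ _ _ h1 h2 h3.1 h3.2)
      · exact h4
      · exact absurd h4 (hlt _ _ _ _ h2 h1 h3.1.symm h3.2.symm)
    subst hq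
    have h4 := (h S q h1).2.1
    have h5 := (h S' q h2).2.1
    rw [h3.2] at h4
    rw [eq_of_light_of_dvd (dvd_mul_left _ _) h4 h5 (h3.2 ▸ weight_le_two_pow_rank S)
      (weight_le_two_pow_rank S')]
  calc ∑ p ∈ B, (2 : ℝ≥0) ^ rank I p.1
      = ∑ x ∈ B.image (fun p => (⟨f p, rank I p.1⟩ : (_ : Finset α) × ℕ)),
          (2 : ℝ≥0) ^ x.2 := by rw [Finset.sum_image hinj]
    _ ≤ ∑ x ∈ (allComponents I).sigma fun T => Finset.range (rank I T), (2 : ℝ≥0) ^ x.2 := by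
        refine Finset.sum_le_sum_of_subset fun x hx => ?_
        obtain ⟨⟨S, q⟩, hp, rfl⟩ := Finset.mem_image.1 hx
        obtain ⟨h1, -, h2⟩ := hf _ hp
        refine Finset.mem_sigma.2 ⟨Finset.mem_biUnion.2 ⟨_, Finset.mem_Icc.2
          ⟨Nat.mul_pos (Nat.succ_pos _) (by positivity), (h S q hp).1⟩, h1⟩,
          Finset.mem_range.2 h2⟩
    _ = ∑ T ∈ allComponents I, ∑ r ∈ Finset.range (rank I T), (2 : ℝ≥0) ^ r := by
        rw [Finset.sum_sigma]
    _ ≤ ∑ T ∈ allComponents I, 2 * I.weight T :=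
        Finset.sum_le_sum fun T _ => sum_two_pow_range_rank_le T
    _ = _ := by rw [Finset.mul_sum]

/-- There are three kinds of blocks, each contributing a factor 2: those in which `S` is absent at
the start, those that `S` does not outlive or that end after time `n`, and those survived entirely.
The first two kinds occur at most once per component, because its lifetime is an interval. -/
theorem sum_blocks_le (I : Input α) :
    ∑ p ∈ blocks I, (2 : ℝ≥0) ^ rank I p.1 ≤ 6 * ∑ S ∈ allComponents I, I.weight S := by
  classical
  rw [← Finset.sum_filter_add_sum_filter_not _ (fun p : Finset α × ℕ =>
      p.1 ∉ adaptiveBinaryCover I (p.2 * 2 ^ rank I p.1)),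
    ← Finset.sum_filter_add_sum_filter_not (Finset.filter (fun p : Finset α × ℕ =>
      ¬ p.1 ∉ adaptiveBinaryCover I (p.2 * 2 ^ rank I p.1)) _) (fun p : Finset α × ℕ =>
      ¬ ((p.2 + 1) * 2 ^ rank I p.1 ≤ I.n ∧
        p.1 ∈ adaptiveBinaryCover I ((p.2 + 1) * 2 ^ rank I p.1)))]
  have e : (6 : ℝ≥0) * ∑ S ∈ allComponents I, I.weight S =
      2 * ∑ S ∈ allComponents I, I.weight S + (2 * ∑ S ∈ allComponents I, I.weight S +
        2 * ∑ S ∈ allComponents I, I.weight S) := by ring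
  rw [e]
  refine add_le_add ?_ (add_le_add ?_ ?_)
  · refine sum_two_pow_rank_le_of_unique (Finset.filter_subset _ _) ?_
    intro S q q' h1 h2 h3
    obtain ⟨h1, -⟩ := Finset.mem_filter.1 h1
    obtain ⟨h2, h2'⟩ := Finset.mem_filter.1 h2
    obtain ⟨t, -, h5, h6, h7, h8⟩ := mem_blocks h1
    obtain ⟨t', -, h5', h6', h7', h8'⟩ := mem_blocks h2
    have h9 : (q + 1) * 2 ^ rank I S ≤ q' * 2 ^ rank I S := Nat.mul_le_mul_right _ h3
    exact h2' (mem_cover_of_mem_of_mem (h8.le.trans h9) h7' h5' (Finset.mem_filter.1 h6).1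
      (Finset.mem_filter.1 h6').1)
  · refine sum_two_pow_rank_le_of_unique
      ((Finset.filter_subset _ _).trans (Finset.filter_subset _ _)) ?_
    intro S q q' h1 h2 h3
    obtain ⟨h1, h1'⟩ := Finset.mem_filter.1 h1
    obtain ⟨h2, -⟩ := Finset.mem_filter.1 h2
    obtain ⟨t, -, h5, h6, h7, h8⟩ := mem_blocks (Finset.mem_filter.1 h1).1
    obtain ⟨t', -, h5', h6', h7', h8'⟩ := mem_blocks (Finset.mem_filter.1 h2).1
    have h9 : (q + 1) * 2 ^ rank I S ≤ q' * 2 ^ rank I S := Nat.mul_le_mul_right _ h3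
    exact h1' ⟨h9.trans (h7'.trans h5'), mem_cover_of_mem_of_mem h8.le (h9.trans h7') h5'
      (Finset.mem_filter.1 h6).1 (Finset.mem_filter.1 h6').1⟩
  · refine sum_survived_blocks_le ((Finset.filter_subset _ _).trans (Finset.filter_subset _ _)) ?_
    intro S q h1
    obtain ⟨h1, h2⟩ := Finset.mem_filter.1 h1
    obtain ⟨-, h3⟩ := Finset.mem_filter.1 h1
    exact ⟨(not_not.1 h2).1, not_not.1 h3, (not_not.1 h2).2⟩

/-- One component per time is left out of `nonlightest`; it is paid by the reference solution, whose
cover is non-empty whenever items are present. -/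
theorem sum_queryCost_le {C : ℕ → Finset (Finset α)} (hC : I.IsSolution C) :
    ∑ t ∈ Finset.Icc 1 I.n, (Input.queryCost (adaptiveBinaryCover I) t : ℝ≥0) ≤
      ∑ t ∈ Finset.Icc 1 I.n, (Input.queryCost C t : ℝ≥0) +
        6 * ∑ t ∈ Finset.Icc 1 I.n, I.buildCost (adaptiveBinaryCover I) t := by
  have h1 : ∀ t ∈ Finset.Icc 1 I.n, (Input.queryCost (adaptiveBinaryCover I) t : ℝ≥0) ≤
      (Input.queryCost C t : ℝ≥0) + ((nonlightest I t).card : ℝ≥0) := by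
    intro t ht
    have h2 : Input.queryCost (adaptiveBinaryCover I) t ≤
        Input.queryCost C t + (nonlightest I t).card := by
      refine (card_cover_le_nonlightest t).trans (Nat.add_le_add_right ?_ _)
      split_ifs with h
      · obtain ⟨S, hS⟩ := h
        obtain ⟨x, hx⟩ := nonempty_of_mem_cover hS
        have h3 : x ∈ (C t).biUnion id := by
          rw [hC.cover t ht]
          exact subset_inserted hS hx
        obtain ⟨T, hT, -⟩ := Finset.mem_biUnion.1 h3
        exact Finset.card_pos.2 ⟨T, hT⟩
      · exact Nat.zero_le _
    exact_mod_cast h2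
  refine (Finset.sum_le_sum h1).trans ?_
  rw [Finset.sum_add_distrib]
  refine add_le_add le_rfl ?_
  have h2 : (∑ t ∈ Finset.Icc 1 I.n, ((nonlightest I t).card : ℝ≥0)) ≤
      ∑ p ∈ blocks I, (2 : ℝ≥0) ^ rank I p.1 := by
    exact_mod_cast sum_card_nonlightest_le I
  exact h2.trans ((sum_blocks_le I).trans (mul_le_mul_right (sum_allComponents_le I) 6))

end Query

theorem cost_le {I : Input α} {C : ℕ → Finset (Finset α)} (hC : I.IsSolution C) (L : ℕ) :
    I.cost (adaptiveBinaryCover I) ≤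
      (7 * (L + 2) + 7 * (loadFactor I.numInsertions L + 1) + 1) * I.cost C := by
  unfold Input.cost
  rw [Finset.sum_add_distrib, Finset.sum_add_distrib]
  have h1 := sum_buildCost_le hC L
  have h2 := sum_queryCost_le hC
  set B := ∑ t ∈ Finset.Icc 1 I.n, I.buildCost (adaptiveBinaryCover I) t
  set Q := ∑ t ∈ Finset.Icc 1 I.n, (Input.queryCost (adaptiveBinaryCover I) t : ℝ≥0)
  set B' := ∑ t ∈ Finset.Icc 1 I.n, I.buildCost C t
  set Q' := ∑ t ∈ Finset.Icc 1 I.n, (Input.queryCost C t : ℝ≥0)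
  set g : ℝ≥0 := (loadFactor I.numInsertions L : ℝ≥0)
  calc B + Q ≤ B + (Q' + 6 * B) := by gcongr
    _ = 7 * B + Q' := by ring
    _ ≤ 7 * ((L + 2) * B' + (g + 1) * Q') + Q' := by gcongr
    _ ≤ 7 * ((L + 2) * B' + (g + 1) * Q') + Q' + (7 * (L + 2) * Q' + 7 * (g + 1) * B' + B') :=
        le_self_add
    _ = _ := by ring

/-! ### The tower function and the final upper bound -/

section Tower

/-- The tower function `1, 2, 4, 16, …`. -/
def tower : ℕ → ℕ
  | 0 => 1
  | h + 1 => 2 ^ tower h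

theorem tower_pos (h : ℕ) : 0 < tower h := by
  cases h <;> simp [tower]

theorem le_tower_of_logStar_le {h : ℕ} {x : ℝ} (hx : logStar x ≤ h) : x ≤ tower h := by
  induction h generalizing x with
  | zero =>
    rw [logStar] at hx
    split_ifs at hx with h1
    · simpa [tower] using h1
    · omega
  | succ h ih =>
    rw [logStar] at hx
    split_ifs at hx with h1
    · exact h1.trans (by exact_mod_cast tower_pos (h + 1))
    · have h2 := ih (x := Real.logb 2 x) (by omega)
      rw [Real.logb_le_iff_le_rpow (by norm_num) (by linarith), Real.rpow_natCast] at h2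
      simpa [tower] using h2

theorem tower_lt_of_lt_logStar {h : ℕ} {x : ℝ} (hx : h < logStar x) : (tower h : ℝ) < x := by
  induction h generalizing x with
  | zero =>
    rw [logStar] at hx
    split_ifs at hx with h1
    · omega
    · simpa [tower] using h1
  | succ h ih =>
    rw [logStar] at hx
    split_ifs at hx with h1
    · omega
    · have h2 := ih (x := Real.logb 2 x) (by omega)
      rw [Real.lt_logb_iff_rpow_lt (by norm_num) (by linarith), Real.rpow_natCast] at h2
      simpa [tower] using h2

theorem one_le_logStar {m : ℕ} (hm : 2 ≤ m) : 1 ≤ logStar (m : ℝ) := by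
  have : (2 : ℝ) ≤ m := by exact_mod_cast hm
  rw [logStar, if_neg (by linarith)]
  omega

/-- The factor 4 keeps the bound invariant: the logarithm of `4 * 2 ^ tower h` is `2 + tower h`, and
adding 1 still leaves at most `4 * tower h`, since `tower h` is at least 1. -/
theorem loadFactor_le {m h k : ℕ} (hm : m ≤ 4 * tower (h + k)) :
    loadFactor m k ≤ 4 * tower h := by
  induction k generalizing h with
  | zero => simpa [loadFactor] using hm
  | succ k ih =>
    rw [loadFactor_succ]
    have h1 := ih (h := h + 1) (by rwa [show h + 1 + k = h + (k + 1) by ring])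
    have h2 : Nat.clog 2 (loadFactor m k) ≤ 2 + tower h := by
      rw [Nat.clog_le_iff_le_pow (by norm_num), pow_add]
      exact h1
    have := tower_pos h
    omega

theorem loadFactor_logStar_le (m : ℕ) : loadFactor m (logStar (m : ℝ)) ≤ 4 := by
  have h1 : m ≤ tower (logStar (m : ℝ)) := by
    exact_mod_cast le_tower_of_logStar_le (x := (m : ℝ)) le_rfl
  exact loadFactor_le (h := 0) (by rw [zero_add]; omega)

end Tower

theorem cost_le_mul_opt {α : Type u} [DecidableEq α] (I : Input α) (hm : 2 ≤ I.numInsertions) :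
    (I.cost (adaptiveBinaryCover I) : ℝ≥0∞) ≤
      ((57 * logStar (I.numInsertions : ℝ) : ℕ) : ℝ≥0∞) * I.opt := by
  set L := logStar (I.numInsertions : ℝ) with hL
  have hL1 : 1 ≤ L := one_le_logStar hm
  rw [← ENNReal.div_le_iff' (by simp; omega) (ENNReal.natCast_ne_top _)]
  refine le_iInf₂ fun C hC => ?_
  rw [ENNReal.div_le_iff' (by simp; omega) (ENNReal.natCast_ne_top _)]
  have h1 := cost_le hC L
  have h2 : (7 * ((L : ℝ≥0) + 2) + 7 * (loadFactor I.numInsertions L + 1) + 1 : ℝ≥0) ≤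
      ((57 * L : ℕ) : ℝ≥0) := by
    have h3 := loadFactor_logStar_le I.numInsertions
    rw [← hL] at h3
    -- With load factor at most 4 the left side is at most `7 * L + 50`, and `L` is at least 1.
    have h4 : 7 * (L + 2) + 7 * (loadFactor I.numInsertions L + 1) + 1 ≤ 57 * L := by omega
    exact_mod_cast h4
  have h5 := h1.trans (mul_le_mul_left h2 _)
  exact_mod_cast h5

theorem competitiveRatio_le {m : ℕ} (hm : 2 ≤ m) :
    competitiveRatio adaptiveBinary.{u} m ≤ ((57 : ℝ≥0) : ℝ≥0∞) * (logStar (m : ℝ) : ℝ≥0∞) := by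
  refine iSup_le fun α => iSup_le fun _ => iSup_le fun I => iSup_le fun hI => ?_
  refine ENNReal.div_le_of_le_mul ((cost_le_mul_opt I (by omega)).trans (le_of_eq ?_))
  rw [hI]
  push_cast
  rfl

/-! ### Lower bound: a list of weights that is rebuilt once per level -/

section Expand

/-- Replace each entry `e` of a list of depths by entries of new, pairwise different depths
larger than `b`, keeping the sum of `2 ^ (- e)`. -/
def expand (b : ℕ) : List ℕ → List ℕ
  | [] => []
  | e :: l => List.replicate (2 ^ (b + l.length + 1 - e)) (b + l.length + 1) ++ expand b l

/-- The pair of a depth bound and a list of depths that arises from `k` expansions. -/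
def expansion : ℕ → ℕ × List ℕ
  | 0 => (0, [0])
  | k + 1 => ((expansion k).1 + (expansion k).2.length, expand (expansion k).1 (expansion k).2)

theorem le_of_mem_expand {b e : ℕ} {l : List ℕ} (h : e ∈ expand b l) : e ≤ b + l.length := by
  induction l with
  | nil => simp [expand] at h
  | cons a l ih =>
    rw [expand, List.mem_append] at h
    rcases h with h | h
    · rw [List.eq_of_mem_replicate h, List.length_cons, add_assoc]
    · have := ih h
      rw [List.length_cons]
      omega

theorem length_expand_le (b : ℕ) (l : List ℕ) :
    (expand b l).length ≤ l.length * 2 ^ (b + l.length) := by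
  induction l with
  | nil => simp [expand]
  | cons a l ih =>
    rw [expand, List.length_append, List.length_replicate, List.length_cons, add_mul, one_mul,
      add_comm]
    refine add_le_add (ih.trans (Nat.mul_le_mul_left _ ?_)) ?_
    · exact Nat.pow_le_pow_right (by norm_num) (by omega)
    · exact Nat.pow_le_pow_right (by norm_num) (by omega)

theorem le_of_mem_expansion {k e : ℕ} (h : e ∈ (expansion k).2) : e ≤ (expansion k).1 := by
  cases k with
  | zero => simpa [expansion] using h
  | succ k => exact le_of_mem_expand h

/-- One expansion turns the bound `K` into at most `K + K * 2 ^ K`, which is at most `2 ^ 2 ^ K`: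
two levels of the tower. -/
theorem expansion_bound (k : ℕ) :
    (expansion k).1 + (expansion k).2.length ≤ tower (2 * k) := by
  induction k with
  | zero => simp [expansion, tower]
  | succ k ih =>
    set K := (expansion k).1 + (expansion k).2.length with hK
    have h1 : (expansion (k + 1)).1 + (expansion (k + 1)).2.length ≤ K + K * 2 ^ K := by
      refine add_le_add le_rfl ((length_expand_le _ _).trans ?_)
      exact Nat.mul_le_mul (by omega) (Nat.pow_le_pow_right (by norm_num) (by omega))
    have h2 : ∀ n : ℕ, n + n * 2 ^ n ≤ 2 ^ 2 ^ n := by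
      intro n
      rcases Nat.eq_zero_or_pos n with rfl | hn
      · simp
      obtain ⟨j, rfl⟩ : ∃ j, n = j + 1 := ⟨n - 1, by omega⟩
      have h3 : j + 1 ≤ 2 ^ j := Nat.lt_two_pow_self
      have h4 : 1 ≤ 2 ^ (j + 1) := Nat.one_le_two_pow
      calc (j + 1) + (j + 1) * 2 ^ (j + 1) ≤ 2 ^ j * 2 ^ (j + 1) + 2 ^ j * 2 ^ (j + 1) := by
            gcongr
            nlinarith
        _ = 2 ^ (2 * (j + 1)) := by ring
        _ ≤ 2 ^ 2 ^ (j + 1) := by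
            refine Nat.pow_le_pow_right (by norm_num) ?_
            rw [pow_succ]
            omega
    refine h1.trans ((h2 K).trans ?_)
    rw [show 2 * (k + 1) = 2 * k + 1 + 1 by ring, tower, tower]
    exact Nat.pow_le_pow_right (by norm_num) (Nat.pow_le_pow_right (by norm_num) ih)

theorem sum_map_expand {H b : ℕ} {l : List ℕ} (hb : b + l.length ≤ H) (hl : ∀ e ∈ l, e ≤ b) :
    ((expand b l).map fun e => (2 : ℝ≥0) ^ (H - e)).sum =
      (l.map fun e => (2 : ℝ≥0) ^ (H - e)).sum := by
  induction l with
  | nil => simp [expand]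
  | cons e l ih =>
    rw [List.length_cons] at hb
    have he := hl e (by simp)
    rw [expand, List.map_append, List.sum_append, ih (by omega)
      (fun e' h => hl e' (List.mem_cons_of_mem _ h)), List.map_replicate, List.sum_replicate,
      List.map_cons, List.sum_cons, nsmul_eq_mul]
    push_cast
    rw [← pow_add, show b + l.length + 1 - e + (H - (b + l.length + 1)) = H - e by omega]

theorem sum_map_expansion {H k : ℕ} (h : (expansion k).1 ≤ H) :
    ((expansion k).2.map fun e => (2 : ℝ≥0) ^ (H - e)).sum = 2 ^ H := by
  induction k with
  | zero => simp [expansion]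
  | succ k ih =>
    have h' : (expansion k).1 + (expansion k).2.length ≤ H := h
    rw [← ih (by omega)]
    exact sum_map_expand h' fun e he => le_of_mem_expansion he

variable {H : ℕ} {X : ℕ → Multiset ℝ≥0} {c : ℕ → ℝ≥0}

/-- If in step `j` all weights up to `2 ^ j` are merged, then the expansion of a list of weights
turns into the list itself, and all of its weight is merged once. -/
theorem merge_expand
    {j₀ : ℕ} (hX : ∀ j, j₀ ≤ j → j < H → 2 ≤ ((X j).filter (· ≤ (2 : ℝ≥0) ^ j)).card →
      X (j + 1) = ((X j).filter (· ≤ (2 : ℝ≥0) ^ j)).sum ::ₘ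
        (X j).filter (fun r => ¬ r ≤ (2 : ℝ≥0) ^ j) ∧
      ((X j).filter (· ≤ (2 : ℝ≥0) ^ j)).sum ≤ c j)
    {b : ℕ} {l : List ℕ} (hl : ∀ e ∈ l, e ≤ b) {R : Multiset ℝ≥0} {j : ℕ}
    (hR : ∀ r ∈ R, (2 : ℝ≥0) ^ (H - b) ≤ r) (hj₀ : j₀ ≤ j) (hj : j + l.length + b = H)
    (hXj : X j = ((expand b l).map fun e => (2 : ℝ≥0) ^ (H - e) : List ℝ≥0) + R) :
    X (j + l.length) = (l.map fun e => (2 : ℝ≥0) ^ (H - e) : List ℝ≥0) + R ∧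
      (l.map fun e => (2 : ℝ≥0) ^ (H - e)).sum ≤ ∑ i ∈ Finset.Ico j (j + l.length), c i := by
  induction l generalizing R j with
  | nil => simpa [expand] using hXj
  | cons e l ih =>
    rw [List.length_cons] at hj
    have he := hl e (by simp)
    have hj' : H - (b + l.length + 1) = j := by omega
    have hXj' : X j = Multiset.replicate (2 ^ (b + l.length + 1 - e)) ((2 : ℝ≥0) ^ j) +
        (((expand b l).map fun e => (2 : ℝ≥0) ^ (H - e) : List ℝ≥0) + R) := by
      rw [hXj, expand, List.map_append, List.map_replicate, hj', ← Multiset.coe_add,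
        Multiset.coe_replicate, add_assoc]
    have hlt : ∀ r ∈ (((expand b l).map fun e => (2 : ℝ≥0) ^ (H - e) : List ℝ≥0) + R :
        Multiset ℝ≥0), ¬ r ≤ (2 : ℝ≥0) ^ j := by
      intro r hr
      rw [not_le]
      rcases Multiset.mem_add.1 hr with hr | hr
      · obtain ⟨e', he', rfl⟩ := List.mem_map.1 (Multiset.mem_coe.1 hr)
        have := le_of_mem_expand he'
        exact pow_lt_pow_right₀ (by norm_num) (by omega)
      · exact (pow_lt_pow_right₀ (by norm_num) (by omega)).trans_le (hR r hr)
    have hle : ∀ r ∈ Multiset.replicate (2 ^ (b + l.length + 1 - e)) ((2 : ℝ≥0) ^ j),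
        r ≤ (2 : ℝ≥0) ^ j := fun r hr => (Multiset.eq_of_mem_replicate hr).le
    have hlight : (X j).filter (· ≤ (2 : ℝ≥0) ^ j) =
        Multiset.replicate (2 ^ (b + l.length + 1 - e)) ((2 : ℝ≥0) ^ j) := by
      rw [hXj', Multiset.filter_add, Multiset.filter_eq_self.2 hle,
        Multiset.filter_eq_nil.2 hlt, add_zero]
    have hheavy : (X j).filter (fun r => ¬ r ≤ (2 : ℝ≥0) ^ j) =
        ((expand b l).map fun e => (2 : ℝ≥0) ^ (H - e) : List ℝ≥0) + R := by
      rw [hXj', Multiset.filter_add, Multiset.filter_eq_self.2 hlt,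
        Multiset.filter_eq_nil.2 fun r hr => not_not.2 (hle r hr), zero_add]
    have hsum : ((X j).filter (· ≤ (2 : ℝ≥0) ^ j)).sum = 2 ^ (H - e) := by
      rw [hlight, Multiset.sum_replicate, nsmul_eq_mul]
      push_cast
      rw [← pow_add]
      congr 1
      omega
    obtain ⟨h1, h2⟩ := hX j hj₀ (by omega) (by
      rw [hlight, Multiset.card_replicate]
      exact Nat.le_self_pow (by omega) 2)
    rw [hsum] at h1 h2
    rw [hheavy, ← Multiset.singleton_add, add_left_comm] at h1
    -- As `e ≤ b`, the weight just created is at least `2 ^ (H - b)`, too heavy for the remaining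
    -- steps of this round, so it joins the untouched rest `R`.
    obtain ⟨h3, h4⟩ := ih (fun e' h => hl e' (List.mem_cons_of_mem _ h))
      (R := {(2 : ℝ≥0) ^ (H - e)} + R) (j := j + 1) (by
        intro r hr
        rw [Multiset.singleton_add, Multiset.mem_cons] at hr
        rcases hr with rfl | hr
        · exact pow_le_pow_right₀ (by norm_num) (by omega)
        · exact hR r hr) (by omega) (by omega) h1
    constructor
    · rw [List.length_cons, show j + (l.length + 1) = j + 1 + l.length by ring, h3,
        List.map_cons, ← Multiset.cons_coe, ← Multiset.singleton_add, add_left_comm, add_assoc]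
    · rw [List.map_cons, List.sum_cons, List.length_cons,
        Finset.sum_eq_sum_Ico_succ_bot (by omega),
        show j + (l.length + 1) = j + 1 + l.length by ring]
      exact add_le_add h2 h4

/-- Undoing one expansion merges the entire weight `2 ^ H` once and leaves the list of the previous
level exactly when its own smallest weights become light. -/
theorem merge_expansion
    {j₀ : ℕ} (hX : ∀ j, j₀ ≤ j → j < H → 2 ≤ ((X j).filter (· ≤ (2 : ℝ≥0) ^ j)).card →
      X (j + 1) = ((X j).filter (· ≤ (2 : ℝ≥0) ^ j)).sum ::ₘ
        (X j).filter (fun r => ¬ r ≤ (2 : ℝ≥0) ^ j) ∧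
      ((X j).filter (· ≤ (2 : ℝ≥0) ^ j)).sum ≤ c j)
    {k j : ℕ} (hj₀ : j₀ ≤ j) (hj : j + (expansion k).1 = H)
    (hXj : X j = ((expansion k).2.map fun e => (2 : ℝ≥0) ^ (H - e) : List ℝ≥0)) :
    k * (2 : ℝ≥0) ^ H ≤ ∑ i ∈ Finset.Ico j H, c i := by
  induction k generalizing j with
  | zero => simp
  | succ k ih =>
    have hj' : j + (expansion k).2.length + (expansion k).1 = H := by
      rw [← hj]; simp only [expansion]; ring
    obtain ⟨h1, h2⟩ := merge_expand hX (b := (expansion k).1) (l := (expansion k).2) (R := 0)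
      (fun e he => le_of_mem_expansion he) (by simp) hj₀ hj' (by rw [add_zero]; exact hXj)
    rw [add_zero] at h1
    have h3 := ih (by omega) hj' h1
    rw [sum_map_expansion (by omega)] at h2
    rw [← Finset.sum_Ico_consecutive _ (Nat.le_add_right j (expansion k).2.length) (by omega)]
    push_cast
    rw [add_mul, one_mul, add_comm]
    exact add_le_add h2 h3

end Expand

/-! ### The algorithm acting on weights when nothing is inserted -/

section Weights

variable {I : Input α}

/-- The weights of the components at time `t`. -/
noncomputable def weights (I : Input α) (t : ℕ) : Multiset ℝ≥0 :=
  (adaptiveBinaryCover I t).val.map I.weight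

theorem available_of_ins_eq_empty {t : ℕ} (h : I.ins (t + 1) = ∅) :
    available I t = adaptiveBinaryCover I t := by
  simp [available, addComponent, h]

theorem cover_succ_of_card_light {t : ℕ} (h : (light I t).card ≤ 1) :
    adaptiveBinaryCover I (t + 1) = available I t := by
  rw [cover_succ, if_neg (by omega)]

theorem filter_weights {t : ℕ} (h : I.ins (t + 1) = ∅) :
    (weights I t).filter (· ≤ (capacity (t + 1) : ℝ≥0)) = (light I t).val.map I.weight := by
  rw [weights, light, available_of_ins_eq_empty h, Finset.filter_val, Multiset.filter_map]
  rfl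

theorem filter_not_weights {t : ℕ} (h : I.ins (t + 1) = ∅) :
    (weights I t).filter (fun r => ¬ r ≤ (capacity (t + 1) : ℝ≥0)) =
      (adaptiveBinaryCover I t \ light I t).val.map I.weight := by
  have h1 : adaptiveBinaryCover I t \ light I t = (adaptiveBinaryCover I t).filter
      fun S => ¬ I.weight S ≤ (capacity (t + 1) : ℝ≥0) := by
    rw [light, available_of_ins_eq_empty h, Finset.filter_not]
  rw [h1, weights, Finset.filter_val, Multiset.filter_map]
  rfl

/-- The effect of a merge on the weights of the components. -/
theorem weights_succ {t : ℕ} (ht : t + 1 ≤ I.n) (h : I.ins (t + 1) = ∅)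
    (hc : 2 ≤ ((weights I t).filter (· ≤ (capacity (t + 1) : ℝ≥0))).card) :
    weights I (t + 1) = ((weights I t).filter (· ≤ (capacity (t + 1) : ℝ≥0))).sum ::ₘ
        (weights I t).filter (fun r => ¬ r ≤ (capacity (t + 1) : ℝ≥0)) ∧
      ((weights I t).filter (· ≤ (capacity (t + 1) : ℝ≥0))).sum ≤
        I.buildCost (adaptiveBinaryCover I) (t + 1) := by
  rw [filter_weights h, Multiset.card_map] at hc
  have hc' : 2 ≤ (light I t).card := hc
  rw [filter_weights h, filter_not_weights h]
  have hav := available_of_ins_eq_empty h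
  have hsub : light I t ⊆ adaptiveBinaryCover I t := hav ▸ light_subset t
  have hdisj := pairwiseDisjoint_cover (I := I) (t := t) (by omega)
  -- The union must be a new component for its weight to appear in the build cost; an old one would,
  -- by disjointness, equal each of the two or more light components.
  have hU : (light I t).biUnion id ∉ adaptiveBinaryCover I t := by
    intro hU
    have key : ∀ S ∈ light I t, S = (light I t).biUnion id := by
      intro S hS
      obtain ⟨x, hx⟩ := nonempty_of_mem_cover (hsub hS)
      exact eq_of_mem_cover (by omega) (hsub hS) hU hx (Finset.mem_biUnion.2 ⟨S, hS, hx⟩)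
    have : (light I t).card ≤ 1 := Finset.card_le_one.2 fun S hS T hT => by
      rw [key S hS, key T hT]
    omega
  have hw : I.weight ((light I t).biUnion id) = ((light I t).val.map I.weight).sum :=
    I.weight_biUnion (hdisj.subset (by exact_mod_cast hsub))
  have hcov : adaptiveBinaryCover I (t + 1) =
      insert ((light I t).biUnion id) (adaptiveBinaryCover I t \ light I t) := by
    rw [cover_succ, if_pos hc', hav]
  rw [← hw]
  constructor
  · rw [weights, hcov, Finset.insert_val_of_notMem (fun h => hU (Finset.sdiff_subset h)),
      Multiset.map_cons]
  · unfold Input.buildCost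
    refine Finset.single_le_sum (f := I.weight) (fun _ _ => zero_le) ?_
    rw [Nat.add_sub_cancel, Finset.mem_sdiff, hcov]
    exact ⟨Finset.mem_insert_self _ _, hU⟩

theorem capacity_le_two_pow {t l : ℕ} (ht : t ≠ 0) (h : t < 2 ^ (l + 1)) : capacity t ≤ 2 ^ l := by
  have h1 := (capacity_le ht).trans_lt h
  rw [capacity, Nat.pow_lt_pow_iff_right (by norm_num)] at h1
  exact Nat.pow_le_pow_right (by norm_num) (by omega)

theorem capacity_two_pow (l : ℕ) : capacity (2 ^ l) = 2 ^ l := by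
  simp [capacity]

/-- Without insertions, nothing happens between consecutive powers of two. -/
theorem cover_eq_of_lt_two_pow {l t : ℕ} (h1 : 2 ^ l ≤ t) (h2 : t < 2 ^ (l + 1))
    (hins : ∀ s, 2 ^ l < s → s ≤ t → I.ins s = ∅) :
    adaptiveBinaryCover I t = adaptiveBinaryCover I (2 ^ l) := by
  induction t, h1 using Nat.le_induction with
  | base => rfl
  | succ t h ih =>
    have ih' := ih (by omega) (fun s h3 h4 => hins s h3 (by omega))
    have hav := available_of_ins_eq_empty (hins (t + 1) (by omega) le_rfl)
    rw [cover_succ_of_card_light, hav, ih']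
    refine Finset.card_le_one.2 fun S hS T hT => ?_
    rw [mem_light, hav, ih'] at hS hT
    have h3 : (capacity (t + 1) : ℝ≥0) ≤ 2 ^ l := by
      exact_mod_cast capacity_le_two_pow (by omega) h2
    exact eq_of_light_of_dvd dvd_rfl hS.1 hT.1 (hS.2.trans h3) (hT.2.trans h3)

end Weights

/-! ### The hard instance and a cheap solution for it -/

section Instance

/-- The input in which items with the given weights are inserted one by one, followed by
`P` items of weight zero that are inserted after time `T`. -/
noncomputable def paddedInput (l : List ℝ≥0) (T P : ℕ) : Input (ULift.{u} ℕ) where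
  n := T + P
  ins t := if t ≤ l.length ∨ T < t then {ULift.up t} else ∅
  wt x := l.getD (x.down - 1) 0
  disjoint_ins := by
    intro s _ t _ hst
    split_ifs <;> simp [hst]

variable {l : List ℝ≥0} {T P : ℕ}

theorem numInsertions_paddedInput (hT : l.length ≤ T) :
    (paddedInput.{u} l T P).numInsertions = l.length + P := by
  have hne : ∀ t, ((paddedInput.{u} l T P).ins t).Nonempty ↔ t ≤ l.length ∨ T < t := by
    intro t
    unfold paddedInput
    dsimp only
    split_ifs with h <;> simp [h]
  have hn : (paddedInput.{u} l T P).n = T + P := rfl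
  have h1 : (Finset.Icc 1 (paddedInput.{u} l T P).n).filter
      (fun t => ((paddedInput.{u} l T P).ins t).Nonempty) =
        Finset.Icc 1 l.length ∪ Finset.Icc (T + 1) (T + P) := by
    ext t
    rw [Finset.mem_filter, hne, hn, Finset.mem_Icc, Finset.mem_union, Finset.mem_Icc,
      Finset.mem_Icc]
    omega
  unfold Input.numInsertions
  rw [h1, Finset.card_union_of_disjoint]
  · simp
  · rw [Finset.disjoint_left]
    intro t h2 h3
    rw [Finset.mem_Icc] at h2 h3
    omega

theorem weight_singleton_paddedInput (t : ℕ) :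
    (paddedInput.{u} l T P).weight {ULift.up t} = l.getD (t - 1) 0 := by
  simp [Input.weight, paddedInput]

theorem ins_paddedInput_of_le {t : ℕ} (ht : t ≤ l.length) :
    (paddedInput.{u} l T P).ins t = {ULift.up t} := by
  simp [paddedInput, ht]

theorem ins_paddedInput_of_lt {t : ℕ} (ht : l.length < t) (hT : t ≤ T) :
    (paddedInput.{u} l T P).ins t = ∅ := by
  simp [paddedInput, ht, hT]

/-- The components of weight at least `2 ^ k` are not merged before time `2 ^ k`. -/
theorem cover_paddedInput {k t : ℕ} (hl : ∀ w ∈ l, (2 : ℝ≥0) ^ k ≤ w) (hk : t < 2 ^ k)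
    (ht : t ≤ l.length) :
    adaptiveBinaryCover (paddedInput.{u} l T P) t =
      (Finset.Icc 1 t).image fun i => {ULift.up i} := by
  induction t with
  | zero => simp [adaptiveBinaryCover]
  | succ t ih =>
    have hav : available (paddedInput.{u} l T P) t =
        (Finset.Icc 1 (t + 1)).image fun i => {ULift.up i} := by
      rw [available, ins_paddedInput_of_le ht, ih (by omega) (by omega), addComponent,
        if_pos (Finset.singleton_nonempty _),
        ← Finset.insert_Icc_right_eq_Icc_add_one (by omega), Finset.image_insert]
    rw [cover_succ_of_card_light, hav]
    refine le_trans (le_of_eq (Finset.card_eq_zero.2 ?_)) zero_le_one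
    refine Finset.filter_eq_empty_iff.2 fun S hS => ?_
    rw [hav] at hS
    obtain ⟨i, hi, rfl⟩ := Finset.mem_image.1 hS
    rw [Finset.mem_Icc] at hi
    rw [weight_singleton_paddedInput, not_le, List.getD_eq_getElem _ _ (by omega)]
    refine lt_of_lt_of_le ?_ (hl _ (List.getElem_mem _))
    exact_mod_cast (capacity_le (by omega)).trans_lt hk

theorem weights_paddedInput {k t : ℕ} (hl : ∀ w ∈ l, (2 : ℝ≥0) ^ k ≤ w) (hk : t < 2 ^ k)
    (ht : l.length ≤ t) (hT : t ≤ T) :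
    weights (paddedInput.{u} l T P) t = (l : Multiset ℝ≥0) := by
  have h1 : adaptiveBinaryCover (paddedInput.{u} l T P) t =
      (Finset.Icc 1 l.length).image fun i => {ULift.up i} := by
    induction t, ht using Nat.le_induction with
    | base => exact cover_paddedInput hl hk le_rfl
    | succ t h ih =>
      have ih' := ih (by omega) (by omega)
      have hav := available_of_ins_eq_empty
        (ins_paddedInput_of_lt.{u} (P := P) (Nat.lt_succ_of_le h) hT)
      rw [cover_succ_of_card_light, hav, ih']
      refine le_trans (le_of_eq (Finset.card_eq_zero.2 ?_)) zero_le_one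
      refine Finset.filter_eq_empty_iff.2 fun S hS => ?_
      rw [hav, ih'] at hS
      obtain ⟨i, hi, rfl⟩ := Finset.mem_image.1 hS
      rw [Finset.mem_Icc] at hi
      rw [weight_singleton_paddedInput, not_le, List.getD_eq_getElem _ _ (by omega)]
      refine lt_of_lt_of_le ?_ (hl _ (List.getElem_mem _))
      exact_mod_cast (capacity_le (by omega)).trans_lt hk
  rw [weights, h1, Finset.image_val_of_injOn (by intro i _ j _ h; simpa using h),
    Multiset.map_map]
  have h2 : (Finset.Icc 1 l.length) = (Finset.range l.length).map (addRightEmbedding 1) := by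
    rw [Finset.range_eq_Ico, Finset.map_add_right_Ico, zero_add]
    rfl
  rw [h2, Finset.map_val, Multiset.map_map]
  simp only [Function.comp_def, addRightEmbedding_apply, weight_singleton_paddedInput,
    Nat.add_sub_cancel, Finset.range_val, Multiset.range]
  rw [Multiset.map_coe]
  congr 1
  refine List.ext_getElem (by simp) fun i h3 h4 => ?_
  rw [List.getElem_map, List.getElem_range, List.getD_eq_getElem _ _ h4]

theorem sum_getD (l : List ℝ≥0) (n : ℕ) :
    ∑ t ∈ Finset.Icc 1 n, l.getD (t - 1) 0 = (l.take n).sum := by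
  induction n with
  | zero => simp
  | succ n ih =>
    rw [Finset.sum_Icc_succ_top (by omega), ih, List.take_add_one, List.sum_append,
      Nat.add_sub_cancel, List.getD_eq_getElem?_getD]
    congr 1
    cases l[n]? with
    | none => rfl
    | some a => exact List.sum_singleton.symm

theorem sum_getD_le (l : List ℝ≥0) (n : ℕ) :
    ∑ t ∈ Finset.Icc 1 n, l.getD (t - 1) 0 ≤ l.sum := by
  rw [sum_getD]
  conv_rhs => rw [← List.take_append_drop n l, List.sum_append]
  exact le_self_add

theorem sum_le_sum_buildCost {k : ℕ} (hl : ∀ w ∈ l, (2 : ℝ≥0) ^ k ≤ w) (hk : l.length < 2 ^ k) :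
    l.sum ≤ ∑ t ∈ Finset.Icc 1 l.length, (paddedInput.{u} l T P).buildCost
      (adaptiveBinaryCover (paddedInput.{u} l T P)) t := by
  have h1 : l.sum = ∑ t ∈ Finset.Icc 1 l.length, l.getD (t - 1) 0 := by
    rw [sum_getD, List.take_length]
  rw [h1]
  refine Finset.sum_le_sum fun t ht => ?_
  rw [Finset.mem_Icc] at ht
  rw [← weight_singleton_paddedInput.{u} (T := T) (P := P)]
  unfold Input.buildCost
  refine Finset.single_le_sum (f := (paddedInput.{u} l T P).weight) (fun _ _ => zero_le) ?_
  rw [cover_paddedInput hl (by omega) (by omega), cover_paddedInput hl (by omega) (by omega)]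
  simp
  omega

/-- The hypothesis `hc` isolates the combinatorics: it bounds the cost of any sequence of multisets
that starts with `l` and follows the merging rule. The term `l.sum` comes from the insertions, which
happen before time `2 ^ k`, and the other term from the times `2 ^ i` with `k ≤ i < H`, so the two
do not overlap. -/
theorem le_cost_paddedInput {k H : ℕ} {c : ℕ} {l : List ℝ≥0} (hkH : k ≤ H)
    (hl : ∀ w ∈ l, (2 : ℝ≥0) ^ k ≤ w) (hk : l.length < 2 ^ k)
    (hc : ∀ (X : ℕ → Multiset ℝ≥0) (f : ℕ → ℝ≥0), X k = (l : Multiset ℝ≥0) →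
      (∀ j, k ≤ j → j < H → 2 ≤ ((X j).filter (· ≤ (2 : ℝ≥0) ^ j)).card →
        X (j + 1) = ((X j).filter (· ≤ (2 : ℝ≥0) ^ j)).sum ::ₘ
          (X j).filter (fun r => ¬ r ≤ (2 : ℝ≥0) ^ j) ∧
        ((X j).filter (· ≤ (2 : ℝ≥0) ^ j)).sum ≤ f j) →
      c * (2 : ℝ≥0) ^ H ≤ ∑ i ∈ Finset.Ico k H, f i) :
    l.sum + c * (2 : ℝ≥0) ^ H ≤ (paddedInput.{u} l (2 ^ H) P).cost
      (adaptiveBinaryCover (paddedInput.{u} l (2 ^ H) P)) := by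
  set I := paddedInput.{u} l (2 ^ H) P with hI
  have hkH2 : 2 ^ k ≤ 2 ^ H := Nat.pow_le_pow_right (by norm_num) hkH
  have hins : ∀ s, 2 ^ k ≤ s → s ≤ 2 ^ H → I.ins s = ∅ := fun s h1 h2 =>
    ins_paddedInput_of_lt (by omega) h2
  have h1 : c * (2 : ℝ≥0) ^ H ≤
      ∑ i ∈ Finset.Ico k H, I.buildCost (adaptiveBinaryCover I) (2 ^ i) := by
    -- The weights are sampled just before the merge at time `2 ^ j`; between that merge and time `2
    -- ^ (j + 1) - 1` the cover is constant.
    refine hc (fun j => weights I (2 ^ j - 1)) _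
      (weights_paddedInput hl (Nat.sub_lt (by positivity) one_pos) (by omega) (by omega)) ?_
    intro j hkj hjH h2
    have h3 : 2 ^ j - 1 + 1 = 2 ^ j := Nat.sub_add_cancel Nat.one_le_two_pow
    have h4 : 2 ^ j < 2 ^ (j + 1) := Nat.pow_lt_pow_right (by norm_num) (by omega)
    have h5 : 2 ^ (j + 1) ≤ 2 ^ H := Nat.pow_le_pow_right (by norm_num) hjH
    have h6 : 2 ^ k ≤ 2 ^ j := Nat.pow_le_pow_right (by norm_num) hkj
    have h7 : ((capacity (2 ^ j - 1 + 1) : ℕ) : ℝ≥0) = 2 ^ j := by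
      rw [h3, capacity_two_pow]; simp
    have h8 := weights_succ (I := I) (t := 2 ^ j - 1) (by
      rw [h3]; exact (h4.le.trans h5).trans (Nat.le_add_right _ _))
      (by rw [h3]; exact hins _ h6 (by omega)) (by rwa [h7])
    rw [h7, h3] at h8
    refine ⟨?_, h8.2⟩
    rw [← h8.1]
    simp only [weights]
    rw [cover_eq_of_lt_two_pow (l := j) (by omega) (by omega)
      (fun s h9 h10 => hins s (by omega) (by omega))]
  have h2 := sum_le_sum_buildCost.{u} (T := 2 ^ H) (P := P) hl hk
  refine (add_le_add h2 h1).trans ?_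
  have hinj : Set.InjOn (fun i : ℕ => 2 ^ i) (Finset.Ico k H : Set ℕ) :=
    fun i _ j _ h => Nat.pow_right_injective le_rfl h
  rw [← Finset.sum_image (f := fun t => I.buildCost (adaptiveBinaryCover I) t) hinj,
    ← Finset.sum_union]
  · unfold Input.cost
    refine (Finset.sum_le_sum fun _ _ => le_self_add).trans (Finset.sum_le_sum_of_subset ?_)
    intro t ht
    rcases Finset.mem_union.1 ht with ht | ht
    · rw [Finset.mem_Icc] at ht ⊢
      exact ⟨ht.1, le_trans (by omega) (Nat.le_add_right (2 ^ H) P)⟩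
    · obtain ⟨i, hi, rfl⟩ := Finset.mem_image.1 ht
      rw [Finset.mem_Ico] at hi
      exact Finset.mem_Icc.2 ⟨Nat.one_le_two_pow,
        (Nat.pow_le_pow_right (by norm_num) hi.2.le).trans (Nat.le_add_right (2 ^ H) P)⟩
  · rw [Finset.disjoint_left]
    intro t ht ht'
    obtain ⟨i, hi, rfl⟩ := Finset.mem_image.1 ht'
    rw [Finset.mem_Ico] at hi
    rw [Finset.mem_Icc] at ht
    have : 2 ^ k ≤ 2 ^ i := Nat.pow_le_pow_right (by norm_num) hi.1
    omega

/-- A solution for a padded input: keep the items separate until all of the first phase are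
inserted, then keep those in one component, and all further items in another one. -/
def twoPhaseCover {α : Type u} [DecidableEq α] (I : Input α) (k t : ℕ) : Finset (Finset α) :=
  if t < k then (I.inserted t).image singleton
  else {I.inserted k, I.inserted t \ I.inserted k}

theorem isSolution_twoPhaseCover {α : Type u} [DecidableEq α] (I : Input α) {k : ℕ} (hk : 0 < k) :
    I.IsSolution (twoPhaseCover I k) := by
  constructor
  · simp [twoPhaseCover, hk, Input.inserted_zero]
  · intro t _
    unfold twoPhaseCover
    split_ifs with h
    · ext x
      simp
    · rw [Finset.biUnion_insert, Finset.singleton_biUnion, id, id,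
        Finset.union_sdiff_of_subset (I.inserted_mono (by omega))]

theorem weight_ins_paddedInput_le (t : ℕ) :
    (paddedInput.{u} l T P).weight ((paddedInput.{u} l T P).ins t) ≤ l.getD (t - 1) 0 := by
  rw [← weight_singleton_paddedInput.{u} (T := T) (P := P)]
  refine Input.weight_mono _ ?_
  unfold paddedInput
  dsimp only
  split_ifs <;> simp

theorem weight_inserted_paddedInput_le (t : ℕ) :
    (paddedInput.{u} l T P).weight ((paddedInput.{u} l T P).inserted t) ≤ l.sum :=
  (Input.weight_biUnion_le _ _ _).trans
    ((Finset.sum_le_sum fun t _ => weight_ins_paddedInput_le t).trans (sum_getD_le l t))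

theorem mem_ins_paddedInput {t : ℕ} {x : ULift.{u} ℕ}
    (h : x ∈ (paddedInput.{u} l T P).ins t) : x = ULift.up t := by
  unfold paddedInput at h
  dsimp only at h
  split_ifs at h
  · simpa using h
  · simp at h

theorem buildCost_twoPhaseCover_le {t : ℕ} (ht : 1 ≤ t) :
    (paddedInput.{u} l T P).buildCost (twoPhaseCover (paddedInput.{u} l T P) l.length) t ≤
      l.getD (t - 1) 0 + if t = l.length then l.sum else 0 := by
  set I := paddedInput.{u} l T P with hI
  obtain ⟨s, rfl⟩ : ∃ s, t = s + 1 := ⟨t - 1, by omega⟩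
  unfold Input.buildCost
  rw [Nat.add_sub_cancel]
  rcases lt_trichotomy (s + 1) l.length with h | h | h
  · rw [if_neg h.ne, add_zero]
    have hsub : twoPhaseCover I l.length (s + 1) \ twoPhaseCover I l.length s ⊆
        {{ULift.up (s + 1)}} := by
      intro S hS
      rw [twoPhaseCover, twoPhaseCover, if_pos h, if_pos (by omega), Finset.mem_sdiff] at hS
      obtain ⟨⟨x, hx, rfl⟩, h2⟩ := (Finset.mem_image.1 hS.1), hS.2
      rw [I.inserted_succ, Finset.mem_union] at hx
      rcases hx with hx | hx
      · exact absurd (Finset.mem_image_of_mem _ hx) h2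
      · rw [mem_ins_paddedInput hx]
        exact Finset.mem_singleton_self _
    refine (Finset.sum_le_sum_of_subset hsub).trans ?_
    rw [Finset.sum_singleton, weight_singleton_paddedInput, Nat.add_sub_cancel]
  · rw [if_pos h]
    refine le_trans ?_ le_add_self
    refine (Finset.sum_le_sum_of_subset Finset.sdiff_subset).trans ?_
    rw [twoPhaseCover, if_neg (by omega)]
    refine (sum_pair_le _ _ _).trans ?_
    rw [h, sdiff_self]
    simpa [Input.weight] using weight_inserted_paddedInput_le (l := l) l.length
  -- After the first phase only the second component changes, and it contains only padding items of
  -- weight zero.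
  · refine le_trans (le_of_eq ?_) zero_le
    refine Finset.sum_eq_zero fun S hS => ?_
    rw [twoPhaseCover, twoPhaseCover, if_neg (by omega), if_neg (by omega), Finset.mem_sdiff,
      Finset.mem_insert, Finset.mem_singleton] at hS
    rcases hS with ⟨rfl | rfl, h2⟩
    · exact absurd (Finset.mem_insert_self _ _) h2
    · refine Finset.sum_eq_zero fun x hx => ?_
      obtain ⟨h3, h4⟩ := Finset.mem_sdiff.1 hx
      obtain ⟨i, hi, hxi⟩ := Finset.mem_biUnion.1 h3
      rw [Finset.mem_Icc] at hi
      have h5 : l.length < i := by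
        by_contra! h5
        exact h4 (Finset.mem_biUnion.2 ⟨i, Finset.mem_Icc.2 ⟨hi.1, h5⟩, hxi⟩)
      rw [mem_ins_paddedInput hxi]
      exact List.getD_eq_default _ _ (by simp only; omega)

theorem queryCost_twoPhaseCover_le (t : ℕ) :
    Input.queryCost (twoPhaseCover (paddedInput.{u} l T P) l.length) t ≤
      (if t ≤ l.length then l.length else 0) + 2 := by
  unfold Input.queryCost twoPhaseCover
  split_ifs with h1 h2 h2
  · refine le_trans (Finset.card_image_le.trans ((Finset.card_biUnion_le_card_mul _ _ 1 ?_).trans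
      ?_)) (Nat.le_add_right _ 2)
    · intro i _
      refine Finset.card_le_one.2 fun x hx y hy => ?_
      rw [mem_ins_paddedInput hx, mem_ins_paddedInput hy]
    · simp; omega
  · omega
  · exact Finset.card_le_two.trans (by omega)
  · exact Finset.card_le_two.trans (by omega)

theorem cost_twoPhaseCover_le :
    (paddedInput.{u} l T P).cost (twoPhaseCover (paddedInput.{u} l T P) l.length) ≤
      2 * l.sum + ((l.length ^ 2 + 2 * (T + P) : ℕ) : ℝ≥0) := by
  have hn : (paddedInput.{u} l T P).n = T + P := rfl
  unfold Input.cost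
  rw [Finset.sum_add_distrib, hn]
  refine add_le_add ?_ ?_
  · refine (Finset.sum_le_sum fun t ht =>
      buildCost_twoPhaseCover_le (Finset.mem_Icc.1 ht).1).trans ?_
    rw [Finset.sum_add_distrib, two_mul, Finset.sum_ite_eq']
    refine add_le_add (sum_getD_le l _) ?_
    split_ifs
    · exact le_rfl
    · exact zero_le
  · rw [← Nat.cast_sum]
    refine Nat.cast_le.2 ((Finset.sum_le_sum fun t _ => queryCost_twoPhaseCover_le t).trans ?_)
    rw [Finset.sum_add_distrib, ← Finset.sum_filter, Finset.sum_const, Finset.sum_const,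
      Nat.card_Icc, smul_eq_mul, smul_eq_mul, pow_two, Nat.add_sub_cancel, mul_comm (T + P)]
    refine Nat.add_le_add_right (Nat.mul_le_mul_right _ ?_) _
    refine (Finset.card_le_card (t := Finset.Icc 1 l.length) fun t ht => ?_).trans (by simp)
    rw [Finset.mem_filter, Finset.mem_Icc] at ht
    exact Finset.mem_Icc.2 ⟨ht.1.1, ht.2⟩

end Instance

/-! ### The lower bound and the main theorem -/

theorem le_competitiveRatio {m : ℕ} (hm : 2 ≤ m) :
    ((12⁻¹ : ℝ≥0) : ℝ≥0∞) * (logStar (m : ℝ) : ℝ≥0∞) ≤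
      competitiveRatio adaptiveBinary.{u} m := by
  have hlog := one_le_logStar hm
  set s := logStar (m : ℝ) with hs
  -- The number `L` of expansions is the largest with `2 * L < log* m`, so that `tower (2 * L) < m`
  -- and the expanded list has fewer than `m` entries.
  obtain ⟨L, hL1, hL2⟩ : ∃ L, 2 * L < s ∧ s ≤ 2 * (L + 1) := ⟨(s - 1) / 2, by omega, by omega⟩
  have htow : tower (2 * L) < m := by exact_mod_cast tower_lt_of_lt_logStar (hs ▸ hL1)
  have hbound := expansion_bound L
  -- The extra `2 * m + 1` makes every weight in the list at least `2 ^ (2 * m + 1)`, so nothing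
  -- merges while the list is inserted, and it makes `2 ^ H` dominate the quadratic query cost of
  -- the first phase.
  set H := (expansion L).1 + (2 * m + 1) with hH
  set l := (expansion L).2.map fun e => (2 : ℝ≥0) ^ (H - e) with hl
  have hlen : l.length < m := by rw [hl, List.length_map]; omega
  have hsum : l.sum = 2 ^ H := sum_map_expansion (by omega)
  have h1 : m < 2 ^ m := Nat.lt_two_pow_self
  have h2 : m < 2 ^ (2 * m + 1) := h1.trans_le (Nat.pow_le_pow_right (by norm_num) (by omega))
  have h3 : 2 ^ (2 * m + 1) ≤ 2 ^ H := Nat.pow_le_pow_right (by norm_num) (by omega)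
  have h4 : m ^ 2 + 2 * m ≤ 2 * 2 ^ H := by
    have : 2 ^ (2 * m + 1) = 2 * (2 ^ m) ^ 2 := by ring
    nlinarith
  have hlb : ∀ w ∈ l, (2 : ℝ≥0) ^ (2 * m + 1) ≤ w := by
    intro w hw
    obtain ⟨e, he, rfl⟩ := List.mem_map.1 hw
    have := le_of_mem_expansion he
    exact pow_le_pow_right₀ (by norm_num) (by omega)
  have halg := le_cost_paddedInput.{u} (P := m - l.length) (k := 2 * m + 1) (H := H) (c := L)
    (by omega) hlb (by omega) fun X f hX hstep =>
      merge_expansion hstep le_rfl (k := L) (by omega) hX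
  have hopt := cost_twoPhaseCover_le.{u} (l := l) (T := 2 ^ H) (P := m - l.length)
  have hpos : 0 < l.length := by
    rcases Nat.eq_zero_or_pos l.length with h | h
    · rw [List.eq_nil_of_length_eq_zero h, List.sum_nil] at hsum
      exact absurd hsum.symm (by positivity)
    · exact h
  set I := paddedInput.{u} l (2 ^ H) (m - l.length) with hI
  have hopt' : I.cost (twoPhaseCover I l.length) ≤ 6 * 2 ^ H := by
    refine hopt.trans ?_
    rw [hsum]
    have h5 : l.length ^ 2 + 2 * (2 ^ H + (m - l.length)) ≤ 4 * 2 ^ H := by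
      have : l.length ^ 2 ≤ m ^ 2 := Nat.pow_le_pow_left hlen.le 2
      omega
    calc (2 : ℝ≥0) * 2 ^ H + ((l.length ^ 2 + 2 * (2 ^ H + (m - l.length)) : ℕ) : ℝ≥0)
        ≤ 2 * 2 ^ H + ((4 * 2 ^ H : ℕ) : ℝ≥0) := by gcongr
      _ = 6 * 2 ^ H := by push_cast; ring
  have hnum : I.numInsertions = m := by
    rw [hI, numInsertions_paddedInput (by omega)]
    omega
  rw [hsum] at halg
  refine le_iSup_of_le (ULift.{u} ℕ) (le_iSup_of_le inferInstance (le_iSup_of_le I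
    (le_iSup_of_le hnum ?_)))
  change _ ≤ (I.cost (adaptiveBinaryCover I) : ℝ≥0∞) / I.opt
  have hne : I.cost (adaptiveBinaryCover I) ≠ 0 := by
    refine (lt_of_lt_of_le ?_ halg).ne'
    positivity
  rw [ENNReal.le_div_iff_mul_le (Or.inr (by exact_mod_cast hne)) (Or.inr ENNReal.coe_ne_top)]
  have h5 : I.opt ≤ I.cost (twoPhaseCover I l.length) :=
    iInf₂_le _ (isSolution_twoPhaseCover I hpos)
  refine (mul_le_mul_right h5 _).trans ?_
  have h6 : (12⁻¹ : ℝ≥0) * s * I.cost (twoPhaseCover I l.length) ≤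
      I.cost (adaptiveBinaryCover I) := by
    have h7 : (s : ℝ≥0) ≤ 2 * (L + 1) := by exact_mod_cast hL2
    -- The algorithm pays at least `(L + 1) * 2 ^ H` against at most `6 * 2 ^ H`, and `s ≤ 2 * (L +
    -- 1)`; hence the constant 1/12.
    calc (12⁻¹ : ℝ≥0) * s * I.cost (twoPhaseCover I l.length)
        ≤ 12⁻¹ * (2 * (L + 1)) * (6 * 2 ^ H) := by gcongr
      _ = 2 ^ H + L * 2 ^ H := by field_simp; ring
      _ ≤ _ := halg
  exact_mod_cast h6

end MinSum

theorem mainTheorem1 :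
    MinSum.IsOnline MinSum.adaptiveBinary.{u} ∧
    ∃ c C : ℝ≥0, 0 < c ∧ 0 < C ∧ ∀ m : ℕ, 2 ≤ m →
      (c : ℝ≥0∞) * (logStar (m : ℝ) : ℝ≥0∞) ≤
        MinSum.competitiveRatio MinSum.adaptiveBinary.{u} m ∧
      MinSum.competitiveRatio MinSum.adaptiveBinary.{u} m ≤
        (C : ℝ≥0∞) * (logStar (m : ℝ) : ℝ≥0∞) :=
  ⟨MinSum.isOnline_adaptiveBinary, 12⁻¹, 57, by positivity, by positivity, fun _ hm =>
    ⟨MinSum.le_competitiveRatio hm, MinSum.competitiveRatio_le hm⟩⟩
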